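/- Let $n\ge 2$, $k\ge 0$, and let $P_k^+=\{m\in\mathbb Z_{\ge0}^n:\sum_i m_i=k\}$, where $m=\hat\lambda$ is identified with the partition $\lambda=(\lambda_1,\dots,\lambda_{n-1})$, $\lambda_i=m_i+\dots+m_{n-1}$, $\lambda_1\le k$. Put $\lambda_n=0$, $|\lambda|=\sum_i\lambda_i$, let $\lambda^t$ be the transposed partition, and let $\hat\emptyset=(0,\dots,0,k)$. Let $\mathbb CP^+$ be the complex vector space with basis $\mathbb Z_{\ge 0}^n$, orthonormal for an inner product $\langle\cdot,\cdot\rangle$ that is antilinear in the first factor, and let $\mathbb CP^+_k$ be the span of $P_k^+$. On $\mathbb CP^+$ let $\varphi_i^*$ raise $m_i$ by one, let $\varphi_i$ lower $m_i$ by one (giving $0$ if $m_i=0$), and put $a_j=\varphi_{j+1}^*\varphi_j$ for $1\le j\le n-1$. For $z=1$ define, for $r\ge 0$ and a partition $\lambda$ as above, $$h_r(\mathcal A)=\sum_{\varepsilon_0+\dots+\varepsilon_{n-1}=r}(\varphi_1^*)^{\varepsilon_0}a_1^{\varepsilon_1}\cdots a_{n-1}^{\varepsilon_{n-1}}\varphi_n^{\varepsilon_0},\qquad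 s_\lambda(\mathcal A)=\det\big(h_{\lambda_i-i+j}(\mathcal A)\big)_{1\le i,j\le n-1},$$ with $h_r(\mathcal A)=0$ for $r<0$. The $h_r(\mathcal A)$ commute with each other on $\mathbb CP_k^+$, so that the determinant is unambiguous there. Let $A(u)=(1+ua_{n-1})\cdots(1+ua_1)$, $B(u)=uA(u)\varphi_1^*$ and $T(u)=A(u)+u\varphi_nA(u)\varphi_1^*$. For $\hat\sigma\in P_k^+$ let $\zeta=e^{2\pi i/(k+n)}$, let $$x_i^\sigma=\zeta^{\frac{|\sigma|}{n}+\frac{k+1}{2}+\sigma^t_{k+1-i}-(k+1-i)}\quad(1\le i\le k),\qquad b_\sigma=B(1/x_1^\sigma)\cdots B(1/x_k^\sigma)\,(0,\dots,0),\qquad \hat b_\sigma=\frac{b_\sigma}{\langle b_\sigma,b_\sigma\rangle}.$$ Let $\rho$ be the Weyl vector of $su(n)$, and let $$S_{\hat\lambda\hat\sigma}=\frac{e^{i\pi n(n-1)/4}}{\sqrt{n(k+n)^{n-1}}}\sum_{w\in\mathbb S_n}(-1)^{\ell(w)}e^{-\frac{2\pi i}{k+n}(\sigma+\rho,\,w(\lambda+\rho))},\qquad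 \mathcal N_{\hat\lambda\hat\mu}^{\hat\nu}=\sum_{\hat\sigma\in P_k^+}\frac{S_{\hat\lambda\hat\sigma}S_{\hat\mu\hat\sigma}(S^{-1})_{\hat\nu\hat\sigma}}{S_{\hat\emptyset\hat\sigma}}.$$ Then the following hold. 1. For $\hat\lambda,\hat\mu\in P_k^+$ the vector $\hat\lambda*\hat\mu:=s_\lambda(\mathcal A)\hat\mu$ lies in $\mathbb CP_k^+$, and the bilinear extension of $*$ makes $\mathbb CP_k^+$ an associative and commutative algebra with unit $\hat\emptyset$. 2. The numbers $\mathcal N_{\hat\lambda\hat\mu}^{\hat\nu}$ are integers and are the structure constants of a commutative, associative ring $\mathcal F_{n,k}$ with $\mathbb Z$-basis $P_k^+$ and unit $\hat\emptyset$ (the fusion ring). The map $\hat\lambda\mapsto 1\otimes\hat\lambda$ is an isomorphism of $\mathbb C$-algebras from $(\mathbb CP_k^+,*)$ to the Verlinde algebra $\mathbb C\otimes_{\mathbb Z}\mathcal F_{n,k}$. 3. The normalised Bethe vectors are orthogonal idempotents: $\hat b_\sigma*\hat b_\tau=\delta_{\sigma,\tau}\,\hat b_\sigma$ for all $\hat\sigma,\hat\tau\in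 P_k^+$. 4. The Bethe ansatz is complete, that is, the vectors $b_\sigma$, $\hat\sigma\in P_k^+$, form a basis of $\mathbb CP_k^+$ that consists of eigenvectors of all $h_r(\mathcal A)$, $r\ge0$, and of all $T(u)$, $u\in\mathbb C$; and this completeness is equivalent to the semisimplicity of the Verlinde algebra (so that both hold). -/

import Mathlib

open scoped TensorProduct

namespace PhaseModel

noncomputable section

/-! ## State space and the phase algebra

Throughout `n = N + 1`, and the node `i ∈ {1, …, n}` of the affine Dynkin diagram is the
element `i - 1` of `Fin (N + 1)`; the affine node `n` is `Fin.last N`. -/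

/-- The state space `ℂP⁺ = 𝓜^{⊗ n}`, with basis the `n`-tuples of Dynkin labels. -/
abbrev State (N : ℕ) : Type := (Fin (N + 1) → ℕ) →₀ ℂ

/-- The basis vector of an `n`-tuple of Dynkin labels. -/
def ket {N : ℕ} (m : Fin (N + 1) → ℕ) : State N := Finsupp.single m 1

/-- The inner product for which the `ket m` are orthonormal, antilinear in the first factor. -/
def inn {N : ℕ} (f g : State N) : ℂ := f.sum fun m c => (starRingEnd ℂ) c * g m

/-- The creation operator `φᵢ*`. -/
def create {N : ℕ} (i : Fin (N + 1)) : Module.End ℂ (State N) :=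
  Finsupp.linearCombination ℂ fun m => ket (m + Pi.single i 1)

/-- The annihilation operator `φᵢ`. -/
def annih {N : ℕ} (i : Fin (N + 1)) : Module.End ℂ (State N) :=
  Finsupp.linearCombination ℂ fun m => if 0 < m i then ket (m - Pi.single i 1) else 0

/-- The plactic generator `a_j = φ_{j+1}* φ_j`, `1 ≤ j ≤ n - 1` (here `j` is counted from `0`). -/
def plac {N : ℕ} (j : Fin N) : Module.End ℂ (State N) := create j.succ * annih j.castSucc

/-- The affine plactic complete symmetric polynomial
`h_r(𝓐) = ∑_{ε ⊢ r} z^{ε₀} (φ₁*)^{ε₀} a₁^{ε₁} ⋯ a_{n-1}^{ε_{n-1}} φ_n^{ε₀}`. -/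
def hOp {N : ℕ} (z : ℂ) (r : ℕ) : Module.End ℂ (State N) :=
  ∑ ε ∈ Finset.piAntidiag (Finset.univ : Finset (Fin (N + 1))) r,
    z ^ ε 0 • (create 0 ^ ε 0 * (List.ofFn fun j : Fin N => plac j ^ ε j.succ).prod *
      annih (Fin.last N) ^ ε 0)

/-- `h_d(𝓐)` for an integer `d`, equal to `0` for `d < 0`. -/
def hOpInt {N : ℕ} (z : ℂ) (d : ℤ) : Module.End ℂ (State N) :=
  if 0 ≤ d then hOp z d.toNat else 0

/-- The affine plactic Schur polynomial `det (h_{lᵢ - i + j}(𝓐))_{1 ≤ i, j ≤ n - 1}`, as the Leibniz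
expansion of the determinant (the entries commute with each other). -/
def schurOp {N : ℕ} (z : ℂ) (l : Fin N → ℕ) : Module.End ℂ (State N) :=
  ∑ w : Equiv.Perm (Fin N), (Equiv.Perm.sign w : ℤ) •
    (List.ofFn fun i : Fin N => hOpInt z ((l i : ℤ) - (i : ℤ) + (w i : ℤ))).prod

/-- `A(u) = (1 + u a_{n-1}) ⋯ (1 + u a₁)`. -/
def opA {N : ℕ} (u : ℂ) : Module.End ℂ (State N) :=
  (List.ofFn fun j : Fin N => 1 + u • plac j.rev).prod

/-- `B(u) = u A(u) φ₁*`. -/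
def opB {N : ℕ} (u : ℂ) : Module.End ℂ (State N) := u • (opA u * create 0)

/-- `D(u) = u φ_n A(u) φ₁*`. -/
def opD {N : ℕ} (u : ℂ) : Module.End ℂ (State N) :=
  u • (annih (Fin.last N) * opA u * create 0)

/-- The auxiliary matrix `T(u) = A(u) + z D(u)`. -/
def opT {N : ℕ} (z u : ℂ) : Module.End ℂ (State N) := opA u + z • opD u

/-! ## Dominant integral weights of level `k` -/

/-- `P_k⁺`: the `n`-tuples of Dynkin labels with sum `k`. -/
abbrev Weight (N k : ℕ) : Type := {m : Fin (N + 1) → ℕ // ∑ i, m i = k}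

instance (N k : ℕ) : Fintype (Weight N k) :=
  Fintype.subtype (Finset.piAntidiag Finset.univ k) (by simp)

/-- The weight `k ω_n` of the empty partition. -/
def vac (N k : ℕ) : Weight N k := ⟨Pi.single (Fin.last N) k, by simp⟩

/-- The `i`-th part of the partition of a weight: `λᵢ = mᵢ + ⋯ + m_{n-1}`, so that
`λᵢ - λᵢ₊₁ = mᵢ` for `i < n` and `λ_n = 0`. -/
def part {N : ℕ} (m : Fin (N + 1) → ℕ) (i : Fin (N + 1)) : ℕ :=
  ∑ j with i ≤ j ∧ j ≠ Fin.last N, m j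

/-- The number `|λ|` of boxes. -/
def size {N : ℕ} (m : Fin (N + 1) → ℕ) : ℕ := ∑ i, part m i

/-- The `j`-th part (`j ≥ 1`) of the transposed partition. -/
def transp {N : ℕ} (m : Fin (N + 1) → ℕ) (j : ℕ) : ℕ :=
  (Finset.univ.filter fun i => j ≤ part m i).card

/-- The partition `λ = (λ₁, …, λ_{n-1})` of a weight of level `k`. -/
def Weight.toPart {N k : ℕ} (l : Weight N k) (i : Fin N) : ℕ := part l.1 i.castSucc

/-- The subspace `ℂP_k⁺` of `ℂP⁺`. -/
def levelSpace (N k : ℕ) : Submodule ℂ (State N) :=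
  Finsupp.supported ℂ ℂ {m | ∑ i, m i = k}

/-- The vector of `ℂP_k⁺` with given coordinates. -/
def toState {N k : ℕ} (f : Weight N k → ℂ) : State N := ∑ m, f m • ket m.1

/-! ## Algebras given by structure constants -/

/-- The bilinear product on `ι → R` with `eᵢ eⱼ = ∑ₗ c i j l • eₗ`. -/
def strMul {R ι : Type} [CommRing R] [Fintype ι] (c : ι → ι → ι → R) (f g : ι → R) : ι → R :=
  fun l => ∑ i, ∑ j, f i * g j * c i j l

/-- The product with structure constants `c` is commutative and associative with unit `e`. -/
structure IsCommAlg {R ι : Type} [CommRing R] [Fintype ι] (c : ι → ι → ι → R) (e : ι → R) :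
    Prop where
  comm : ∀ f g, strMul c f g = strMul c g f
  assoc : ∀ f g h, strMul c (strMul c f g) h = strMul c f (strMul c g h)
  unit : ∀ f, strMul c e f = f

/-- The free module `ι → R` with the product of structure constants `c`. -/
def StrAlg {R ι : Type} [CommRing R] [Fintype ι] {c : ι → ι → ι → R} {e : ι → R}
    (_h : IsCommAlg c e) : Type := ι → R

section StrAlg

variable {R ι : Type} [CommRing R] [Fintype ι] {c : ι → ι → ι → R} {e : ι → R}

/-- The element with given coordinates. -/
def StrAlg.of (h : IsCommAlg c e) (f : ι → R) : StrAlg h := f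

instance (h : IsCommAlg c e) : AddCommGroup (StrAlg h) :=
  inferInstanceAs (AddCommGroup (ι → R))

theorem strMul_add (f g h : ι → R) : strMul c f (g + h) = strMul c f g + strMul c f h := by
  funext l
  simp only [strMul, Pi.add_apply, mul_add, add_mul, Finset.sum_add_distrib]

theorem add_strMul (f g h : ι → R) : strMul c (f + g) h = strMul c f h + strMul c g h := by
  funext l
  simp only [strMul, Pi.add_apply, add_mul, Finset.sum_add_distrib]

theorem zero_strMul (f : ι → R) : strMul c 0 f = 0 := by
  funext l
  simp [strMul]

theorem strMul_zero (f : ι → R) : strMul c f 0 = 0 := by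
  funext l
  simp [strMul]

theorem smul_strMul (r : R) (f g : ι → R) : strMul c (r • f) g = r • strMul c f g := by
  funext l
  simp only [strMul, Pi.smul_apply, smul_eq_mul, Finset.mul_sum]
  refine Finset.sum_congr rfl fun i _ => Finset.sum_congr rfl fun j _ => ?_
  ring

theorem strMul_smul (r : R) (f g : ι → R) : strMul c f (r • g) = r • strMul c f g := by
  funext l
  simp only [strMul, Pi.smul_apply, smul_eq_mul, Finset.mul_sum]
  refine Finset.sum_congr rfl fun i _ => Finset.sum_congr rfl fun j _ => ?_
  ring

instance (h : IsCommAlg c e) : CommRing (StrAlg h) :=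
  { (inferInstance : AddCommGroup (StrAlg h)) with
    mul := fun f g => strMul c f g
    one := e
    left_distrib := fun f g k => strMul_add f g k
    right_distrib := fun f g k => add_strMul f g k
    zero_mul := fun f => zero_strMul f
    mul_zero := fun f => strMul_zero f
    mul_assoc := h.assoc
    one_mul := h.unit
    mul_one := fun f => (h.comm f e).trans (h.unit f)
    mul_comm := h.comm }

end StrAlg

instance {ι : Type} [Fintype ι] {c : ι → ι → ι → ℂ} {e : ι → ℂ} (h : IsCommAlg c e) :
    Module ℂ (StrAlg h) :=
  inferInstanceAs (Module ℂ (ι → ℂ))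

instance {ι : Type} [Fintype ι] {c : ι → ι → ι → ℂ} {e : ι → ℂ} (h : IsCommAlg c e) :
    Algebra ℂ (StrAlg h) :=
  Algebra.ofModule
    (fun r f g => smul_strMul r f g)
    (fun r f g => strMul_smul r f g)

/-! ## The combinatorial product -/

/-- The structure constants of `λ̂ * μ̂ = s_λ(𝓐) μ̂` on `ℂP_k⁺`: the coefficient of `ν̂`. -/
def combConst (N k : ℕ) (z : ℂ) (l m v : Weight N k) : ℂ :=
  schurOp z l.toPart (ket m.1) v.1

/-! ## The modular `S`-matrix and the Verlinde formula -/

/-- The vector `λ + ρ` of the weight space of `su(n)`, realised in `ℝⁿ` as the hyperplane of vectors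
with coordinate sum zero. -/
def rhoShift {N : ℕ} (m : Fin (N + 1) → ℕ) (i : Fin (N + 1)) : ℝ :=
  ((part m i : ℝ) - (size m : ℝ) / (N + 1)) + ((N : ℝ) / 2 - (i : ℝ))

/-- The Kac-Peterson formula
`S_{λσ} = e^{iπn(n-1)/4} (n (k+n)^{n-1})^{-1/2} ∑_w (-1)^{ℓ(w)} e^{-2πi (σ+ρ, w(λ+ρ)) / (k+n)}`. -/
def modularS (N k : ℕ) : Matrix (Weight N k) (Weight N k) ℂ := fun l s =>
  Complex.exp (Complex.I * Real.pi * ((N + 1) * N) / 4) /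
      (Real.sqrt (((N : ℝ) + 1) * ((k : ℝ) + (N + 1)) ^ N) : ℂ) *
    ∑ w : Equiv.Perm (Fin (N + 1)), ((Equiv.Perm.sign w : ℤ) : ℂ) *
      Complex.exp (-(2 * Real.pi * Complex.I / ((k : ℂ) + (N + 1))) *
        ((∑ i, rhoShift s.1 i * rhoShift l.1 (w⁻¹ i) : ℝ) : ℂ))

/-- The fusion coefficient `N_{λμ}^{(k)ν}`, by the Verlinde formula. -/
def fusionCoeff (N k : ℕ) (l m v : Weight N k) : ℂ :=
  ∑ s, modularS N k l s * modularS N k m s * (modularS N k)⁻¹ v s / modularS N k (vac N k) s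

/-! ## Bethe vectors at `z = 1` -/

/-- The Bethe roots `x^σ = ζ^{|σ|/n} (ζ^{I₁}, …, ζ^{I_k})` with `ζ = exp(2πi/(k+n))` and
`I = ((k+1)/2 + σᵗ_k - k, …, (k+1)/2 + σᵗ_1 - 1)`. -/
def betheRoot {N k : ℕ} (s : Weight N k) (i : Fin k) : ℂ :=
  Complex.exp (2 * Real.pi * Complex.I / ((k : ℂ) + (N + 1)) *
    ((size s.1 : ℂ) / (N + 1) +
      (((k : ℂ) + 1) / 2 + (transp s.1 (k - i) : ℂ) - ((k : ℂ) - (i : ℂ)))))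

/-- The Bethe vector `b_σ = B(x₁⁻¹) ⋯ B(x_k⁻¹) Ω̂`, with `Ω̂` the tuple `(0, …, 0)`. -/
def betheVec {N k : ℕ} (s : Weight N k) : State N :=
  (List.ofFn fun i : Fin k => opB (betheRoot s i)⁻¹).prod (ket 0)

/-- The coordinates in `ℂP_k⁺` of the normalised Bethe vector `b_σ / ⟨b_σ, b_σ⟩`. -/
def betheHat {N k : ℕ} (s : Weight N k) : Weight N k → ℂ := fun m =>
  betheVec s m.1 / inn (betheVec s) (betheVec s)

/-- Completeness of the Bethe ansatz at `z = 1`: the Bethe vectors form a basis of `ℂP_k⁺` that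
consists of eigenvectors of the auxiliary matrix `T(u)` for all `u` and of the transfer matrix
`Q(u) = ∑_r u^r h_r(𝓐)`, that is, of all its coefficients `h_r(𝓐)`. -/
def BetheComplete (N k : ℕ) : Prop :=
  LinearIndependent ℂ (fun s : Weight N k => betheVec s) ∧
  Submodule.span ℂ (Set.range fun s : Weight N k => betheVec s) = levelSpace N k ∧
  ∀ s : Weight N k,
    (∀ r : ℕ, ∃ a : ℂ, hOp 1 r (betheVec s) = a • betheVec s) ∧
    (∀ u : ℂ, ∃ a : ℂ, opT 1 u (betheVec s) = a • betheVec s)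

end

end PhaseModel

namespace PhaseModel

noncomputable section

/-! ## Coefficients of the images of the basic operators -/

/-! The model is one of free fermions. A tuple `m` of level `k` is encoded by the strictly
decreasing integers `pos m i` in `[0, k + N]`, with `pos m 0 = k + N`, and the operators move these
particles. For numbers `y_j` with product one and `y_j ^ (k + n) = κ` for all `j`, the plane wave
with coordinates `det (y_j ^ pos_i)` is a common eigenvector: a forbidden move would put two
particles on one site, where the determinant vanishes; equality of the powers handles the passage
around the circle and product one makes a common shift of all particles harmless. Then `T(u)` has
eigenvalue `∏ (1 + u / y_j)` (`opT_wave`), `h_r(𝓐)` with `r < k + n` has the complete symmetric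
function of the `1 / y_j` (`hOp_wave`), and `s_λ(𝓐)` has their Schur function (`schurOp_wave`).

Each weight `σ` yields such numbers, the exponentials `rootY` of the coordinates of `σ + ρ`. For
them the coordinates of the wave are, up to normalisation and inversion, entries of the Kac-Peterson
matrix (`modularS_eq`). The Bethe roots are the complementary roots of unity, so elementary
symmetric functions on one side are complete ones on the other, and the dual Jacobi-Trudi
determinant `opB_prod_apply` makes each Bethe vector a multiple of a wave (`betheVec_eq`).

Orthogonality of the waves comes from `T(u)`: its transpose is `T(u)` conjugated by reversal of the
labels, and its eigenvalues separate weights. Hence the waves form a basis, `S` is invertible, and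
expanding a basis vector in waves shows that the coefficients of `s_λ(𝓐) μ̂` are the Verlinde sums
(`schurOp_ket`). The ratios `chi` of entries of `S` are characters which identify the algebra with
functions on the weights; associativity, commutativity, semisimplicity and the idempotents are read
off there. Integrality holds because `s_λ(𝓐)` preserves the lattice spanned by the tuples. -/

theorem single_le_of_pos {ι : Type*} [DecidableEq ι] {m : ι → ℕ} {i : ι} (h : 0 < m i) :
    Pi.single i 1 ≤ m := by
  intro j
  by_cases hj : j = i
  · subst hj; simpa using Nat.succ_le_of_lt h
  · simp [hj]

theorem create_ket {N : ℕ} (i : Fin (N + 1)) (m : Fin (N + 1) → ℕ) :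
    create i (ket m) = ket (m + Pi.single i 1) := by
  simp [create, ket]

theorem annih_ket {N : ℕ} (i : Fin (N + 1)) (m : Fin (N + 1) → ℕ) :
    annih i (ket m) = if 0 < m i then ket (m - Pi.single i 1) else 0 := by
  simp [annih, ket]

theorem ket_apply {N : ℕ} (m m' : Fin (N + 1) → ℕ) :
    ket m m' = if m = m' then 1 else 0 := by
  simp [ket, Finsupp.single_apply]

theorem linearMap_ext_ket {N : ℕ} {V : Type*} [AddCommGroup V] [Module ℂ V]
    {f g : State N →ₗ[ℂ] V} (h : ∀ m, f (ket m) = g (ket m)) : f = g :=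
  Finsupp.lhom_ext' fun m => LinearMap.ext_ring (h m)

theorem create_apply {N : ℕ} (i : Fin (N + 1)) (f : State N) (m : Fin (N + 1) → ℕ) :
    create i f m = if 0 < m i then f (m - Pi.single i 1) else 0 := by
  induction f using Finsupp.induction_linear with
  | zero => simp
  | add f g hf hg =>
    rw [map_add, Finsupp.add_apply, hf, hg]
    split_ifs <;> simp
  | single a b =>
    have h : (Finsupp.single a b : State N) = b • ket a := by simp [ket]
    rw [h, map_smul, create_ket, Finsupp.smul_apply, Finsupp.smul_apply, ket_apply, ket_apply]
    by_cases h0 : 0 < m i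
    · have : a + Pi.single i 1 = m ↔ a = m - Pi.single i 1 := by
        rw [eq_comm, ← tsub_eq_iff_eq_add_of_le (single_le_of_pos h0), eq_comm]
      simp [h0, this]
    · have : ¬ a + Pi.single i 1 = m := by
        rintro rfl
        simp at h0
      simp [h0, this]

theorem annih_apply {N : ℕ} (i : Fin (N + 1)) (f : State N) (m : Fin (N + 1) → ℕ) :
    annih i f m = f (m + Pi.single i 1) := by
  induction f using Finsupp.induction_linear with
  | zero => simp
  | add f g hf hg => rw [map_add, Finsupp.add_apply, hf, hg, Finsupp.add_apply]
  | single a b =>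
    have h : (Finsupp.single a b : State N) = b • ket a := by simp [ket]
    rw [h, map_smul, annih_ket, Finsupp.smul_apply, Finsupp.smul_apply, ket_apply]
    by_cases h0 : 0 < a i
    · have : a = m + Pi.single i 1 ↔ a - Pi.single i 1 = m := by
        rw [tsub_eq_iff_eq_add_of_le (single_le_of_pos h0)]
      simp [h0, this, ket_apply]
    · have : ¬ a = m + Pi.single i 1 := by
        rintro rfl
        simp at h0
      simp [h0, this]

theorem plac_apply {N : ℕ} (j : Fin N) (f : State N) (m : Fin (N + 1) → ℕ) :
    plac j f m = if 0 < m j.succ then f (m - Pi.single j.succ 1 + Pi.single j.castSucc 1)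
      else 0 := by
  rw [plac, Module.End.mul_apply, create_apply, annih_apply]

/-! ## Particle positions -/

/-- The strictly decreasing positions `∑_{j ≥ i} m_j + N - i` attached to a tuple of labels. -/
def pos {N : ℕ} (m : Fin (N + 1) → ℕ) (i : Fin (N + 1)) : ℤ :=
  ∑ j with i ≤ j, (m j : ℤ) + (N - i)

theorem pos_last {N : ℕ} (m : Fin (N + 1) → ℕ) : pos m (Fin.last N) = m (Fin.last N) := by
  have : (Finset.univ.filter fun j : Fin (N + 1) => Fin.last N ≤ j) = {Fin.last N} := by
    ext j; simp [Fin.last_le_iff]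
  rw [pos, this]; simp

theorem pos_castSucc {N : ℕ} (m : Fin (N + 1) → ℕ) (i : Fin N) :
    pos m i.castSucc = pos m i.succ + m i.castSucc + 1 := by
  have : (Finset.univ.filter fun j : Fin (N + 1) => i.castSucc ≤ j) =
      insert i.castSucc (Finset.univ.filter fun j : Fin (N + 1) => i.succ ≤ j) := by
    ext j
    simp only [Finset.mem_filter, Finset.mem_univ, true_and, Finset.mem_insert, Fin.le_def,
      Fin.ext_iff, Fin.val_succ, Fin.val_castSucc]
    omega
  rw [pos, this, Finset.sum_insert (by simp [Fin.le_def]), pos]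
  simp only [Fin.val_succ, Fin.val_castSucc]
  push_cast
  ring

theorem pos_zero {N : ℕ} (m : Fin (N + 1) → ℕ) : pos m 0 = (∑ i, m i : ℕ) + N := by
  simp [pos]

/-- The last position and the gaps determine all positions by downward recursion, so the effect of
an operator on positions only has to be checked on these data. -/
theorem pos_unique {N : ℕ} {m : Fin (N + 1) → ℕ} {l : Fin (N + 1) → ℤ} (c : ℤ)
    (h : l (Fin.last N) = m (Fin.last N) + c)
    (h' : ∀ i : Fin N, l i.castSucc = l i.succ + m i.castSucc + 1) (i : Fin (N + 1)) :
    pos m i = l i - c := by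
  induction i using Fin.reverseInduction with
  | last => rw [pos_last, h]; ring
  | cast i ih => rw [pos_castSucc, ih, h']; ring

theorem pos_move {N : ℕ} (m : Fin (N + 1) → ℕ) (t : Fin N) (h : 0 < m t.succ)
    (i : Fin (N + 1)) :
    pos (m - Pi.single t.succ 1 + Pi.single t.castSucc 1) i =
      pos m i - if i = t.succ then 1 else 0 := by
  rw [pos_unique (l := fun i => pos m i - if i = t.succ then 1 else 0) 0, sub_zero]
  · by_cases hl : Fin.last N = t.succ
    · have hq := pos_last m
      rw [hl] at hq ⊢
      have hc : t.succ ≠ t.castSucc := by simp [Fin.ext_iff]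
      rw [hq]
      simp [hc]
      omega
    · have hc : Fin.last N ≠ t.castSucc := (Fin.castSucc_lt_last t).ne'
      simp [hl, hc, pos_last]
  · intro i
    rw [pos_castSucc]
    by_cases h1 : i.castSucc = t.castSucc
    · have h1' : i = t := Fin.castSucc_injective _ h1
      subst h1'
      have hc : i.castSucc ≠ i.succ := by simp [Fin.ext_iff]
      simp [hc]
    · have h1' : i ≠ t := fun h => h1 (by rw [h])
      by_cases h2 : i.castSucc = t.succ
      · have h3 : t.castSucc ≠ t.succ := by simp [Fin.ext_iff]
        simp only [h2, Pi.add_apply, Pi.sub_apply, Pi.single_eq_same, Fin.succ_inj, h1', if_false,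
          if_true, Pi.single_eq_of_ne h3.symm]
        omega
      · simp [h1, h1', h2]

theorem pos_add_last {N : ℕ} (m : Fin (N + 1) → ℕ) (i : Fin (N + 1)) :
    pos (m + Pi.single (Fin.last N) 1) i = pos m i + 1 := by
  rw [pos_unique (l := fun i => pos m i + 1) 0, sub_zero]
  · simp [pos_last]
  · intro i
    have : i.castSucc ≠ Fin.last N := (Fin.castSucc_lt_last i).ne
    rw [pos_castSucc]
    simp [this]
    ring

theorem pos_sub_zero {N : ℕ} (m : Fin (N + 1) → ℕ) (h : 0 < m 0) (i : Fin (N + 1)) :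
    pos (m - Pi.single 0 1) i = pos m i - if i = 0 then 1 else 0 := by
  rcases N with _ | N
  · rw [Fin.fin_one_eq_zero i]
    have h1 := pos_last m
    have h2 := pos_last (m - Pi.single 0 1)
    simp only [Fin.last_zero] at h1 h2
    rw [h1, h2]
    simp
    omega
  rw [pos_unique (l := fun i => pos m i - if i = 0 then 1 else 0) 0, sub_zero]
  · simp [pos_last, Fin.last_eq_zero_iff]
  · intro i
    rw [pos_castSucc]
    by_cases h0 : i = 0
    · subst h0
      simp
      omega
    · have : i.castSucc ≠ 0 := by simpa using h0
      simp [this]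

theorem sum_move {N : ℕ} (m : Fin (N + 1) → ℕ) (t : Fin N) (h : 0 < m t.succ) :
    ∑ i, (m - Pi.single t.succ 1 + Pi.single t.castSucc 1 : Fin (N + 1) → ℕ) i = ∑ i, m i := by
  have h1 := pos_zero (m - Pi.single t.succ 1 + Pi.single t.castSucc 1)
  rw [pos_move m t h, pos_zero, if_neg (Fin.succ_ne_zero t).symm] at h1
  omega

/-! ## The action of `A(u)` on determinantal states -/

theorem prod_ofFn_rev {M : Type*} [Monoid M] (F : ℕ → M) (n : ℕ) :
    (List.ofFn fun j : Fin n => F j.rev).prod =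
      Nat.rec 1 (fun t x => F t * x) n := by
  induction n with
  | zero => simp
  | succ n ih =>
    rw [List.ofFn_succ, List.prod_cons, Fin.rev_zero, Fin.val_last]
    simp only [Fin.rev_succ, Fin.val_castSucc, ih]

/-- The rows of a determinantal state after the action of the first `t` factors of `A(u)`. -/
def stripRows {N : ℕ} (f : ℤ → Fin (N + 1) → ℂ) (r : Fin (N + 1) → ℂ) (u : ℂ) (t : ℕ)
    (l : Fin (N + 1) → ℤ) : Matrix (Fin (N + 1)) (Fin (N + 1)) ℂ :=
  Matrix.of fun i => if i = 0 then r else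
    if (i : ℕ) ≤ t then f (l i) + u • f (l i - 1) else f (l i)

/-- The factors of `A(u)` act one row at a time: on coefficients, `plac t` lowers position `t + 1`
by one, and multilinearity merges both terms into the row `f l + u • f (l - 1)`. The move is blocked
when label `t + 1` is zero, but then the extra determinant has two proportional rows. For the last
particle the other row is row `0`, which is why `f (-1)` must be a multiple of `r`. -/
theorem opA_apply {N : ℕ} (f : ℤ → Fin (N + 1) → ℂ) (r : Fin (N + 1) → ℂ) (u c : ℂ)
    (hc : f (-1) = c • r) (g : State N) (d : ℕ)
    (hg : ∀ m, g m = if ∑ i, m i = d then (stripRows f r u 0 (pos m)).det else 0)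
    (m : Fin (N + 1) → ℕ) :
    opA u g m = if ∑ i, m i = d then (stripRows f r u N (pos m)).det else 0 := by
  have hA : opA (N := N) u = Nat.rec (motive := fun _ => Module.End ℂ (State N)) 1
      (fun t x => (if h : t < N then 1 + u • plac ⟨t, h⟩ else 1) * x) N := by
    rw [opA, ← prod_ofFn_rev (fun t => if h : t < N then 1 + u • plac (N := N) ⟨t, h⟩ else 1)]
    congr 2
    funext j
    rw [dif_pos j.rev.2]
  rw [hA]
  suffices h : ∀ t, t ≤ N → ∀ m, (Nat.rec (motive := fun _ => Module.End ℂ (State N)) 1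
      (fun t x => (if h : t < N then 1 + u • plac ⟨t, h⟩ else 1) * x) t) g m =
      if ∑ i, m i = d then (stripRows f r u t (pos m)).det else 0 from h N le_rfl m
  intro t
  induction t with
  | zero => intro _ m; simpa using hg m
  | succ t ih =>
    intro ht m
    have htN : t < N := ht
    simp only [dif_pos htN, Module.End.mul_apply]
    rw [LinearMap.add_apply, LinearMap.smul_apply, Module.End.one_apply, Finsupp.add_apply,
      Finsupp.smul_apply, plac_apply, ih htN.le, ih htN.le]
    set s : Fin N := ⟨t, htN⟩ with hs
    by_cases hd : ∑ i, m i = d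
    swap
    · by_cases h0 : 0 < m s.succ
      · rw [sum_move m s h0]; simp [hd]
      · simp [hd, h0]
    have h1 : stripRows f r u t (pos m) =
        (stripRows f r u (t + 1) (pos m)).updateRow s.succ (f (pos m s.succ)) := by
      ext i j
      by_cases hi : i = s.succ
      · subst hi
        simp [stripRows, hs]
      · have : (i : ℕ) ≠ t + 1 := fun h => hi (Fin.ext (by simpa [hs] using h))
        have h' : (i : ℕ) ≤ t ↔ (i : ℕ) ≤ t + 1 := by omega
        simp [stripRows, Matrix.updateRow_ne hi, h']
    have h2 : (stripRows f r u (t + 1) (pos m)) =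
        (stripRows f r u (t + 1) (pos m)).updateRow s.succ
          (f (pos m s.succ) + u • f (pos m s.succ - 1)) := by
      ext i j
      by_cases hi : i = s.succ
      · subst hi
        simp [stripRows, hs]
      · simp [Matrix.updateRow_ne hi]
    have h3 : (if 0 < m s.succ then
        if ∑ i, (m - Pi.single s.succ 1 + Pi.single s.castSucc 1 : Fin (N + 1) → ℕ) i = d then
          (stripRows f r u t (pos (m - Pi.single s.succ 1 + Pi.single s.castSucc 1))).det
        else 0 else 0) =
        ((stripRows f r u (t + 1) (pos m)).updateRow s.succ (f (pos m s.succ - 1))).det := by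
      by_cases h0 : 0 < m s.succ
      · rw [if_pos h0, sum_move m s h0, if_pos hd]
        rw [funext (pos_move m s h0)]
        congr 1
        ext i j
        by_cases hi : i = s.succ
        · subst hi
          simp [stripRows, hs]
        · have : (i : ℕ) ≠ t + 1 := fun h => hi (Fin.ext (by simpa [hs] using h))
          have h' : (i : ℕ) ≤ t ↔ (i : ℕ) ≤ t + 1 := by omega
          simp [stripRows, h', hi]
      · rw [if_neg h0]
        have h0' : m s.succ = 0 := by omega
        symm
        -- A blocked particle would land on the next one, whose row is not yet modified; the last
        -- particle would land on site `-1`, where `hc` produces a multiple of row `0`.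
        by_cases hN : t + 1 = N
        · have hl : s.succ = Fin.last N := Fin.ext (by simpa [hs] using hN)
          have hp : pos m s.succ - 1 = -1 := by
            rw [hl, pos_last, ← hl, h0']; norm_num
          rw [hp, hc, Matrix.det_updateRow_smul]
          rw [Matrix.det_zero_of_row_eq (i := 0) (j := s.succ) (Fin.succ_ne_zero s).symm, mul_zero]
          rw [Matrix.updateRow_self, Matrix.updateRow_ne (Fin.succ_ne_zero s).symm]
          ext j
          simp [stripRows]
        · have hlt : t + 1 < N := by omega
          set q : Fin N := ⟨t + 1, hlt⟩ with hq
          have hqs : q.castSucc = s.succ := Fin.ext (by simp [hs, hq])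
          have hp : pos m s.succ - 1 = pos m q.succ := by
            rw [← hqs, pos_castSucc, hqs, h0']; push_cast; ring
          have hne : q.succ ≠ s.succ := by simp [hs, hq, Fin.ext_iff]
          rw [hp]
          apply Matrix.det_zero_of_row_eq hne
          rw [Matrix.updateRow_self, Matrix.updateRow_ne hne]
          ext j
          simp [stripRows, hq]
    rw [if_pos hd, if_pos hd, h3, h1]
    conv_rhs => rw [h2]
    rw [Matrix.det_updateRow_add, Matrix.det_updateRow_smul, smul_eq_mul]

/-- At level `d + 1` the leading particle sits at `d + 1 + N`, and creation at the first node pulls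
it back to `d + N`. If the first label is zero, particle `1` already occupies that site and the
determinant vanishes; this needs a second row, hence `1 ≤ N`. -/
theorem create_zero_stripRows {N : ℕ} (hN : 1 ≤ N) (f : ℤ → Fin (N + 1) → ℂ) (d : ℕ)
    (g : State N)
    (hg : ∀ m, g m = if ∑ i, m i = d then (Matrix.of fun i => f (pos m i)).det else 0)
    (m : Fin (N + 1) → ℕ) :
    create 0 g m = if ∑ i, m i = d + 1 then
      (stripRows f (f (d + N)) 0 0 (pos m)).det else 0 := by
  rw [create_apply]
  by_cases h0 : 0 < m 0
  · have h1 := pos_zero m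
    have h2 := pos_zero (m - Pi.single 0 1)
    rw [pos_sub_zero m h0, if_pos rfl] at h2
    have h3 : ∑ i, (m - Pi.single 0 1 : Fin (N + 1) → ℕ) i = d ↔ ∑ i, m i = d + 1 := by omega
    rw [if_pos h0, hg]
    simp only [h3]
    split_ifs with hd
    · congr 1
      ext i j
      by_cases hi : i = 0
      · subst hi
        simp [stripRows, pos_sub_zero m h0, h1, hd]
        congr 1
        ring
      · have : ¬ (i : ℕ) ≤ 0 := fun h => hi (Fin.ext (by simpa using h))
        simp [stripRows, hi, pos_sub_zero m h0]
    · rfl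
  · rw [if_neg h0]
    split_ifs with hd
    · symm
      obtain ⟨M, rfl⟩ : ∃ M, N = M + 1 := ⟨N - 1, by omega⟩
      apply Matrix.det_zero_of_row_eq (i := 0) (j := 1) (by simp)
      have h1 := pos_castSucc m 0
      rw [Fin.castSucc_zero, pos_zero, hd] at h1
      have h2 : pos m 1 = d + (M + 1 : ℕ) := by
        rw [Fin.succ_zero_eq_one] at h1
        push_cast at h1 ⊢
        omega
      ext j
      simp [stripRows, h2]
    · rfl

/-! ## The auxiliary matrix on plane waves -/

/-- The Slater determinant `det (y_j ^ l_i)`. -/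
def slater {N : ℕ} (y : Fin (N + 1) → ℂ) (l : Fin (N + 1) → ℤ) : ℂ :=
  (Matrix.of fun i j => y j ^ l i).det

theorem slater_add_const {N : ℕ} {y : Fin (N + 1) → ℂ} (hy : ∏ j, y j = 1)
    (l : Fin (N + 1) → ℤ) (c : ℤ) : slater y (fun i => l i + c) = slater y l := by
  have h0 : ∀ j, y j ≠ 0 := fun j h => by
    rw [Finset.prod_eq_zero (Finset.mem_univ j) h] at hy
    exact zero_ne_one hy
  have := Matrix.det_mul_row (fun j => y j ^ c) (Matrix.of fun i j => y j ^ l i)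
  rw [Finset.prod_zpow, hy, one_zpow, one_mul] at this
  rw [slater, slater, ← this]
  congr 1
  ext i j
  simp [zpow_add₀ (h0 j), mul_comm]

/-- The vector of `ℂP_k⁺` whose coordinates are Slater determinants. -/
def wave {N : ℕ} (k : ℕ) (y : Fin (N + 1) → ℂ) : State N :=
  toState fun m : Weight N k => slater y (pos m.1)

theorem toState_apply {N k : ℕ} (f : Weight N k → ℂ) (m : Fin (N + 1) → ℕ) :
    toState f m = if h : ∑ i, m i = k then f ⟨m, h⟩ else 0 := by
  simp only [toState, Finsupp.finsetSum_apply, Finsupp.smul_apply, ket_apply, smul_eq_mul,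
    mul_ite, mul_one, mul_zero]
  split_ifs with h
  · rw [Finset.sum_eq_single ⟨m, h⟩]
    · simp
    · intro b _ hb
      rw [if_neg fun h' => hb (Subtype.ext h')]
    · simp
  · refine Finset.sum_eq_zero fun b _ => if_neg fun h' => h ?_
    rw [← h', b.2]

theorem wave_apply {N k : ℕ} (y : Fin (N + 1) → ℂ) (m : Fin (N + 1) → ℕ) :
    wave k y m = if ∑ i, m i = k then slater y (pos m) else 0 := by
  rw [wave, toState_apply]
  split_ifs <;> rfl

/-- `A(u)` gives every row except row `0` the form `y ^ l + u y ^ (l - 1)`, while `D(u)` gives the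
same matrix with row `0` replaced by `u y ^ (k + N - 1)`. Their sum completes row `0`, and the
factor `1 + u / y_j` comes out of each column. -/
theorem opT_wave {N k : ℕ} (hN : 1 ≤ N) {y : Fin (N + 1) → ℂ} (hy : ∏ j, y j = 1) {κ : ℂ}
    (hκ : ∀ j, y j ^ (k + (N + 1)) = κ) (u : ℂ) :
    opT 1 u (wave k y) = (∏ j, (1 + u * (y j)⁻¹)) • wave k y := by
  have h0 : ∀ j, y j ≠ 0 := fun j h => by
    rw [Finset.prod_eq_zero (Finset.mem_univ j) h] at hy
    exact zero_ne_one hy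
  have hκ0 : κ ≠ 0 := by rw [← hκ 0]; exact pow_ne_zero _ (h0 0)
  set f : ℤ → Fin (N + 1) → ℂ := fun l j => y j ^ l with hf
  have hc : f (-1) = κ⁻¹ • f (k + N) := by
    ext j
    simp only [hf, Pi.smul_apply, smul_eq_mul, ← hκ j]
    rw [← zpow_natCast, ← zpow_neg, ← zpow_add₀ (h0 j)]
    congr 1
    push_cast
    ring
  have hw : ∀ m, wave k y m = if ∑ i, m i = k then (Matrix.of fun i => f (pos m i)).det else 0 :=
    wave_apply y
  have hA := opA_apply f (f (k + N)) u _ hc (wave k y) k (fun m => by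
    rw [hw]
    split_ifs with hd
    · congr 1
      ext i j
      by_cases hi : i = 0
      · subst hi
        simp [stripRows, pos_zero, hd]
      · simp [stripRows, hi]
    · rfl)
  have hD := opA_apply f (f (k + N)) u _ hc (create 0 (wave k y)) (k + 1) (fun m => by
    rw [create_zero_stripRows hN f k _ hw]
    split_ifs with hd
    · congr 1
      ext i j
      by_cases hi : i = 0 <;> simp [stripRows, hi]
    · rfl)
  ext m
  rw [opT, one_smul, LinearMap.add_apply, opD, Finsupp.add_apply, LinearMap.smul_apply,
    Finsupp.smul_apply, Module.End.mul_apply, Module.End.mul_apply, annih_apply, hA, hD,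
    Finsupp.smul_apply, wave_apply]
  have hs : ∑ i, (m + Pi.single (Fin.last N) 1 : Fin (N + 1) → ℕ) i = k + 1 ↔
      ∑ i, m i = k := by
    simp [Finset.sum_add_distrib]
  simp only [hs]
  split_ifs with hd
  swap
  · simp
  -- Annihilation at the affine node evaluates the coefficients with all positions raised by one;
  -- dividing column `j` by `y j` undoes this because the product of the `y j` is one.
  have hL : (stripRows f (f (k + N)) u N (pos (m + Pi.single (Fin.last N) 1))).det =
      (stripRows f (f (k + N - 1)) u N (pos m)).det := by
    have := Matrix.det_mul_row y (stripRows f (f (k + N - 1)) u N (pos m))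
    rw [hy, one_mul] at this
    rw [← this]
    congr 1
    ext i j
    have hi' : (i : ℕ) ≤ N := Nat.lt_succ_iff.mp i.2
    by_cases hi : i = 0
    · simp [stripRows, hi, hf, zpow_sub_one₀ (h0 j)]
      field_simp [h0 j]
    · simp [stripRows, hi, hi', hf, pos_add_last, zpow_sub_one₀ (h0 j), zpow_add_one₀ (h0 j)]
      field_simp [h0 j]
  have hrow : ∀ r : Fin (N + 1) → ℂ, stripRows f r u N (pos m) =
      (stripRows f (f (k + N)) u N (pos m)).updateRow 0 r := by
    intro r
    ext i j
    by_cases hi : i = 0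
    · subst hi; simp [stripRows]
    · simp [stripRows, hi]
  rw [hL, hrow (f (k + N)), hrow (f (k + N - 1)), smul_eq_mul, ← Matrix.det_updateRow_smul,
    ← Matrix.det_updateRow_add, smul_eq_mul, slater, ← Matrix.det_mul_row]
  congr 1
  ext i j
  have hi' : (i : ℕ) ≤ N := Nat.lt_succ_iff.mp i.2
  by_cases hi : i = 0
  · subst hi
    simp [hf, pos_zero, hd, zpow_sub_one₀ (h0 j)]
    ring
  · simp [stripRows, hi, hi', hf, zpow_sub_one₀ (h0 j)]
    ring

/-! ## Bethe vectors off shell -/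

/-- The elementary symmetric functions of a list, indexed by the integers. -/
def elem (us : List ℂ) (d : ℤ) : ℂ :=
  if d < 0 then 0 else ((us.map fun u => 1 + Polynomial.C u * Polynomial.X).prod).coeff d.toNat

theorem elem_neg (us : List ℂ) {d : ℤ} (h : d < 0) : elem us d = 0 := if_pos h

theorem elem_cons (u : ℂ) (us : List ℂ) (d : ℤ) :
    elem (u :: us) d = elem us d + u * elem us (d - 1) := by
  unfold elem
  split_ifs with h1 h2 h2
  · simp
  · omega
  · have : d = 0 := by omega
    subst this
    simp [add_mul, mul_assoc]
  · obtain ⟨n, rfl⟩ : ∃ n : ℕ, d = n + 1 := ⟨(d - 1).toNat, by omega⟩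
    have h3 : ((n : ℤ) + 1).toNat = n + 1 := by omega
    have h4 : ((n : ℤ) + 1 - 1).toNat = n := by omega
    rw [h3, h4, List.map_cons, List.prod_cons, add_mul, one_mul, Polynomial.coeff_add, mul_assoc,
      Polynomial.coeff_C_mul, Polynomial.coeff_X_mul]

theorem elem_of_length_lt (us : List ℂ) {d : ℤ} (h : us.length < d) : elem us d = 0 := by
  induction us generalizing d with
  | nil =>
    simp only [List.length_nil] at h
    unfold elem
    rw [if_neg (by omega)]
    simp only [List.map_nil, List.prod_nil, Polynomial.coeff_one]
    rw [if_neg (by omega)]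
  | cons u us ih =>
    simp only [List.length_cons] at h
    push_cast at h
    rw [elem_cons, ih (by omega), ih (by omega)]
    simp

/-- A dual Jacobi-Trudi formula, valid for arbitrary arguments. Each `B(u)` acts on rows by
`opA_apply`, and the recursion `e_d(u, us) = e_d(us) + u e_{d-1}(us)` is exactly the resulting row
operation. Row `0` keeps only the second term, as `e_d(us)` vanishes beyond the length; here `f (-1)
= 0`, so no periodicity is needed. -/
theorem opB_prod_apply {N : ℕ} (hN : 1 ≤ N) (us : List ℂ) (m : Fin (N + 1) → ℕ) :
    (us.map (opB (N := N))).prod (ket 0) m = if ∑ i, m i = us.length then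
      (Matrix.of fun i j : Fin (N + 1) => elem us (pos m i - N + j)).det else 0 := by
  induction us generalizing m with
  | nil =>
    simp only [List.map_nil, List.prod_nil, Module.End.one_apply, ket_apply, List.length_nil]
    have : 0 = m ↔ ∑ i, m i = 0 := by
      rw [Finset.sum_eq_zero_iff, eq_comm, funext_iff]
      simp
    simp only [this]
    split_ifs with h
    · have h0 : m = 0 := by rw [← this] at h; exact h.symm
      subst h0
      rw [← Matrix.det_one (n := Fin (N + 1)) (R := ℂ)]
      congr 1
      ext i j
      have hp : pos (0 : Fin (N + 1) → ℕ) i = N - i := by simp [pos]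
      rw [Matrix.of_apply, hp, Matrix.one_apply, elem]
      simp only [List.map_nil, List.prod_nil, Polynomial.coeff_one, Fin.ext_iff]
      split_ifs <;> first | rfl | omega
    · rfl
  | cons u us ih =>
    set f : ℤ → Fin (N + 1) → ℂ := fun l j => elem us (l - N + j) with hf
    have hc : f (-1) = (0 : ℂ) • f (us.length + N) := by
      ext j
      simp only [hf, zero_smul, Pi.zero_apply]
      exact elem_neg _ (by have := j.2; omega)
    have hB := opA_apply f (f (us.length + N)) u _ hc
      (create 0 ((us.map (opB (N := N))).prod (ket 0))) (us.length + 1) (fun m => by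
        rw [create_zero_stripRows hN f us.length _ ih]
        split_ifs with hd
        · congr 1
          ext i j
          by_cases hi : i = 0 <;> simp [stripRows, hi]
        · rfl)
    rw [List.map_cons, List.prod_cons, Module.End.mul_apply, opB, LinearMap.smul_apply,
      Module.End.mul_apply, Finsupp.smul_apply, hB, List.length_cons]
    split_ifs with hd
    swap
    · simp
    have hrow : ∀ r : Fin (N + 1) → ℂ, stripRows f r u N (pos m) =
        (stripRows f (f (us.length + N)) u N (pos m)).updateRow 0 r := by
      intro r
      ext i j
      by_cases hi : i = 0
      · subst hi; simp [stripRows]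
      · simp [stripRows, hi]
    rw [hrow (f (us.length + N)), smul_eq_mul, ← Matrix.det_updateRow_smul]
    congr 1
    ext i j
    have hi' : (i : ℕ) ≤ N := Nat.lt_succ_iff.mp i.2
    rw [Matrix.of_apply, elem_cons]
    by_cases hi : i = 0
    · subst hi
      rw [elem_of_length_lt us (by rw [pos_zero, hd]; push_cast; omega), zero_add,
        Matrix.updateRow_self, Pi.smul_apply, smul_eq_mul, pos_zero, hd]
      simp only [hf]
      congr 2
      push_cast
      ring
    · simp only [stripRows, hf, Matrix.updateRow_ne hi, Matrix.of_apply, if_neg hi, if_pos hi',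
        Pi.add_apply, Pi.smul_apply, smul_eq_mul]
      congr 3
      ring

/-! ## The transpose of the auxiliary matrix -/

/-- The bilinear form for which the `ket m` are orthonormal, as a linear form in the second
argument. -/
def dot {N : ℕ} (g : State N) : State N →ₗ[ℂ] ℂ := Finsupp.linearCombination ℂ fun m => g m

theorem dot_ket {N : ℕ} (g : State N) (m : Fin (N + 1) → ℕ) : dot g (ket m) = g m := by
  simp [dot, ket]

/-- `Y` is the transpose of `X`. -/
def IsTransp {N : ℕ} (X Y : Module.End ℂ (State N)) : Prop :=
  ∀ f g, dot g (X f) = dot (Y g) f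

theorem isTransp_of_ket {N : ℕ} {X Y : Module.End ℂ (State N)}
    (h : ∀ m g, dot g (X (ket m)) = Y g m) : IsTransp X Y := by
  intro f g
  have : dot g ∘ₗ X = dot (Y g) := linearMap_ext_ket fun m => by
    rw [LinearMap.comp_apply, h, dot_ket]
  exact LinearMap.congr_fun this f

theorem isTransp_create {N : ℕ} (i : Fin (N + 1)) : IsTransp (create i) (annih i) :=
  isTransp_of_ket fun m g => by rw [create_ket, dot_ket, annih_apply]

theorem isTransp_annih {N : ℕ} (i : Fin (N + 1)) : IsTransp (annih i) (create i) :=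
  isTransp_of_ket fun m g => by
    rw [annih_ket, create_apply]
    split_ifs
    · rw [dot_ket]
    · simp

theorem isTransp_one {N : ℕ} : IsTransp (1 : Module.End ℂ (State N)) 1 := fun _ _ => rfl

theorem dot_add {N : ℕ} (g h : State N) : dot (g + h) = dot g + dot h :=
  linearMap_ext_ket fun m => by simp [dot_ket]

theorem dot_smul {N : ℕ} (c : ℂ) (g : State N) : dot (c • g) = c • dot g :=
  linearMap_ext_ket fun m => by simp [dot_ket]

theorem IsTransp.add {N : ℕ} {X Y X' Y' : Module.End ℂ (State N)} (h : IsTransp X Y)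
    (h' : IsTransp X' Y') : IsTransp (X + X') (Y + Y') := fun f g => by
  rw [LinearMap.add_apply, LinearMap.add_apply, dot_add, map_add, h, h', LinearMap.add_apply]

theorem IsTransp.smul {N : ℕ} {X Y : Module.End ℂ (State N)} (h : IsTransp X Y) (c : ℂ) :
    IsTransp (c • X) (c • Y) := fun f g => by
  rw [LinearMap.smul_apply, LinearMap.smul_apply, dot_smul, map_smul, h, LinearMap.smul_apply]

theorem IsTransp.mul {N : ℕ} {X Y X' Y' : Module.End ℂ (State N)} (h : IsTransp X Y)
    (h' : IsTransp X' Y') : IsTransp (X * X') (Y' * Y) := fun f g => by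
  rw [Module.End.mul_apply, h, h', Module.End.mul_apply]

theorem isTransp_list_prod {N n : ℕ} (X Y : Fin n → Module.End ℂ (State N))
    (h : ∀ i, IsTransp (X i) (Y i.rev)) : IsTransp (List.ofFn X).prod (List.ofFn Y).prod := by
  induction n with
  | zero => simpa using isTransp_one
  | succ n ih =>
    rw [List.ofFn_succ, List.prod_cons, List.ofFn_succ', List.concat_eq_append, List.prod_append,
      List.prod_singleton]
    refine (by simpa using h 0 : IsTransp (X 0) (Y (Fin.last n))).mul (ih _ _ fun i => ?_)
    simpa [Fin.rev_succ] using h i.succ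

/-- The reversal of the labels. -/
def reflect {N : ℕ} : Module.End ℂ (State N) :=
  Finsupp.linearCombination ℂ fun m => ket (m ∘ Fin.rev)

theorem reflect_ket {N : ℕ} (m : Fin (N + 1) → ℕ) :
    reflect (ket m) = ket (m ∘ Fin.rev) := by
  simp [reflect, ket]

theorem reflect_toState {N k : ℕ} (f : (Fin (N + 1) → ℕ) → ℂ) :
    reflect (toState fun m : Weight N k => f m.1) =
      toState fun m : Weight N k => f (m.1 ∘ Fin.rev) := by
  have hs : ∀ m : Fin (N + 1) → ℕ, ∑ i, m i = k → ∑ i, (m ∘ Fin.rev) i = k := fun m hm => by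
    rw [← hm]; exact Equiv.sum_comp Fin.revPerm m
  simp only [toState, map_sum, map_smul, reflect_ket]
  refine Finset.sum_bij' (fun m _ => ⟨m.1 ∘ Fin.rev, hs _ m.2⟩) (fun m _ => ⟨m.1 ∘ Fin.rev, hs _ m.2⟩)
    (by simp) (by simp) ?_ ?_ ?_
  · intro m _; ext i; simp
  · intro m _; ext i; simp
  · intro m _
    congr 2
    funext i; simp

theorem comp_rev_single {N : ℕ} (i : Fin (N + 1)) :
    (Pi.single i 1 : Fin (N + 1) → ℕ) ∘ Fin.rev = Pi.single i.rev 1 := by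
  funext j
  simp only [Function.comp, Pi.single_apply, Fin.rev_eq_iff]

theorem create_reflect {N : ℕ} (i : Fin (N + 1)) :
    create i * reflect = (reflect * create i.rev : Module.End ℂ (State N)) :=
  linearMap_ext_ket fun m => by
    rw [Module.End.mul_apply, Module.End.mul_apply, reflect_ket, create_ket, create_ket,
      reflect_ket]
    congr 1
    rw [← Fin.rev_rev i, ← comp_rev_single, Fin.rev_rev]
    rfl

theorem annih_reflect {N : ℕ} (i : Fin (N + 1)) :
    annih i * reflect = (reflect * annih i.rev : Module.End ℂ (State N)) :=
  linearMap_ext_ket fun m => by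
    rw [Module.End.mul_apply, Module.End.mul_apply, reflect_ket, annih_ket, annih_ket]
    simp only [Function.comp]
    split_ifs
    · rw [reflect_ket]
      congr 1
      rw [← Fin.rev_rev i, ← comp_rev_single, Fin.rev_rev]
      rfl
    · simp

/-- Transposition exchanges creation and annihilation and reverses products; reversal of the labels
restores the original factors in the original order. -/
theorem isTransp_opT {N : ℕ} (u : ℂ) : ∃ Y : Module.End ℂ (State N),
    IsTransp (opT 1 u) Y ∧ Y * reflect = reflect * opT 1 u := by
  set A' : Module.End ℂ (State N) := (List.ofFn fun j : Fin N =>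
    1 + u • (create j.castSucc * annih j.succ)).prod with hA'
  have h1 : IsTransp (opA u) A' := by
    refine isTransp_list_prod _ _ fun i => isTransp_one.add (IsTransp.smul ?_ u)
    exact (isTransp_create _).mul (isTransp_annih _)
  have h2 : ∀ (n : ℕ) (X Y : Fin n → Module.End ℂ (State N)),
      (∀ i, Y i * reflect = reflect * X i) →
      (List.ofFn Y).prod * reflect = reflect * (List.ofFn X).prod := by
    intro n
    induction n with
    | zero => intro X Y _; simp
    | succ n ih =>
      intro X Y h
      rw [List.ofFn_succ, List.prod_cons, List.ofFn_succ, List.prod_cons, mul_assoc,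
        ih _ _ fun i => h i.succ, ← mul_assoc, h, mul_assoc]
  have h3 : A' * reflect = reflect * opA u := by
    refine h2 N _ _ fun i => ?_
    rw [add_mul, mul_add, one_mul, mul_one, smul_mul_assoc, mul_smul_comm, mul_assoc,
      annih_reflect, ← mul_assoc, create_reflect, mul_assoc, plac, Fin.rev_succ, Fin.rev_castSucc]
  refine ⟨A' + (1 : ℂ) • (u • (annih 0 * (A' * create (Fin.last N)))), ?_, ?_⟩
  · refine h1.add (IsTransp.smul (IsTransp.smul ?_ u) 1)
    have := ((isTransp_annih (Fin.last N)).mul h1).mul (isTransp_create 0)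
    exact this
  · rw [opT, opD, add_mul, mul_add, h3, one_smul, one_smul, smul_mul_assoc, mul_smul_comm,
      mul_assoc, mul_assoc, create_reflect, ← mul_assoc A', h3, ← mul_assoc, ← mul_assoc,
      annih_reflect, Fin.rev_last, Fin.rev_zero]
    simp only [mul_assoc]

/-- Reversing the labels reflects the particles on the circle of `k + n` sites. The index is negated
cyclically, so particle `0` is fixed, and its correction by `k + n` returns it to the site `k + N`.
-/
theorem pos_rev {N k : ℕ} (hN : 1 ≤ N) (m : Fin (N + 1) → ℕ) (hm : ∑ i, m i = k)
    (i : Fin (N + 1)) : pos (m ∘ Fin.rev) i =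
      (k + N - 1) - pos m (-i) + if i = 0 then (k + (N + 1) : ℤ) else 0 := by
  have h0 := pos_zero m
  rw [hm] at h0
  have hcs : ∀ a : ℕ, ∀ (h1 : a < N + 1) (h2 : a + 1 < N + 1),
      pos m ⟨a, h1⟩ = pos m ⟨a + 1, h2⟩ + m ⟨a, h1⟩ + 1 := fun a h1 h2 =>
    pos_castSucc m ⟨a, by omega⟩
  rw [pos_unique (l := fun i => (k + N - 1) - pos m (-i) + if i = 0 then (k + (N + 1) : ℤ) else 0)
    0, sub_zero]
  · have hl : -(Fin.last N) = 1 := by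
      rw [neg_eq_iff_add_eq_zero]
      exact Fin.last_add_one N
    have h1 : Fin.last N ≠ 0 := by
      simp [Fin.ext_iff]; omega
    have h2 := hcs 0 (by omega) (by omega)
    have h3 : (⟨0 + 1, by omega⟩ : Fin (N + 1)) = 1 := by
      obtain ⟨M, rfl⟩ : ∃ M, N = M + 1 := ⟨N - 1, by omega⟩
      rfl
    rw [h3] at h2
    rw [hl]
    simp only [h1, if_false, Function.comp, Fin.rev_last]
    have h4 : (⟨0, by omega⟩ : Fin (N + 1)) = 0 := rfl
    rw [h4] at h2
    omega
  · intro i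
    have hv : ∀ j : Fin (N + 1), j ≠ 0 → ((-j : Fin (N + 1)) : ℕ) = N + 1 - j := by
      intro j hj
      rw [Fin.val_neg', Nat.mod_eq_of_lt]
      have : (j : ℕ) ≠ 0 := fun h => hj (Fin.ext h)
      omega
    have e1 : -i.succ = (⟨N - i, by omega⟩ : Fin (N + 1)) := by
      ext; rw [hv _ (Fin.succ_ne_zero i)]; simp
    have e3 : (m ∘ Fin.rev) i.castSucc = m ⟨N - i, by omega⟩ := by
      simp only [Function.comp]
      congr 1
      ext; simp [Fin.val_rev]
    simp only [Fin.succ_ne_zero, if_false, e1, e3]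
    by_cases hi : i.castSucc = 0
    · have hi' : (i : ℕ) = 0 := by simpa [Fin.ext_iff] using hi
      have e4 : (⟨N - i, by omega⟩ : Fin (N + 1)) = Fin.last N := by ext; simp [hi']
      rw [e4, pos_last]
      simp only [hi, neg_zero, if_true]
      omega
    · have hi' : (i : ℕ) ≠ 0 := fun h => hi (Fin.ext (by simpa using h))
      have e2 : -i.castSucc = (⟨N - i + 1, by omega⟩ : Fin (N + 1)) := by
        ext; rw [hv _ hi]; simp; omega
      have := hcs (N - i) (by omega) (by omega)
      simp only [hi, if_false, e2]
      omega

/-- The reflection of positions inverts the `y j`. The constant collects the sign of cyclic negation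
and the factor `κ` from row `0`; the common power `y ^ (k + N - 1)` disappears since the product of
the `y j` is one. -/
theorem slater_rev {N k : ℕ} (hN : 1 ≤ N) {y : Fin (N + 1) → ℂ} (hy : ∏ j, y j = 1) {κ : ℂ}
    (hκ : ∀ j, y j ^ (k + (N + 1)) = κ) : ∃ c : ℂ, c ≠ 0 ∧ ∀ m : Fin (N + 1) → ℕ,
      ∑ i, m i = k → slater y⁻¹ (pos m) = c * slater y (pos (m ∘ Fin.rev)) := by
  have h0 : ∀ j, y j ≠ 0 := fun j h => by
    rw [Finset.prod_eq_zero (Finset.mem_univ j) h] at hy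
    exact zero_ne_one hy
  have hκ0 : κ ≠ 0 := by rw [← hκ 0]; exact pow_ne_zero _ (h0 0)
  set s : ℂ := ((Equiv.Perm.sign (Equiv.neg (Fin (N + 1))) : ℤ) : ℂ) with hs
  have hs0 : s ≠ 0 := by
    rw [hs]; exact_mod_cast (Equiv.Perm.sign (Equiv.neg (Fin (N + 1)))).ne_zero
  suffices h : ∀ m : Fin (N + 1) → ℕ, ∑ i, m i = k →
      slater y (pos (m ∘ Fin.rev)) = (κ * s) * slater y⁻¹ (pos m) from
    ⟨(κ * s)⁻¹, inv_ne_zero (mul_ne_zero hκ0 hs0), fun m hm => by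
      rw [h m hm, inv_mul_cancel_left₀ (mul_ne_zero hκ0 hs0)]⟩
  intro m hm
  have h1 := Matrix.det_permute (Equiv.neg (Fin (N + 1))) (Matrix.of fun i j => y⁻¹ j ^ pos m i)
  have h2 := Matrix.det_mul_column (fun i => if i = 0 then κ else 1)
    ((Matrix.of fun i j => y⁻¹ j ^ pos m i).submatrix (Equiv.neg (Fin (N + 1))) id)
  have h3 := Matrix.det_mul_row (fun j => y j ^ (k + N - 1 : ℤ))
    (Matrix.of fun i j => (if i = 0 then κ else 1) *
      ((Matrix.of fun i j => y⁻¹ j ^ pos m i).submatrix (Equiv.neg (Fin (N + 1))) id) i j)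
  rw [Finset.prod_zpow, hy, one_zpow, one_mul, h2, h1] at h3
  rw [mul_assoc, slater, slater]
  simp only [Finset.prod_ite_eq', Finset.mem_univ, if_true] at h3
  rw [← h3]
  congr 1
  ext i j
  rw [Matrix.of_apply, pos_rev hN m hm, Matrix.of_apply, Matrix.of_apply, Matrix.submatrix_apply,
    Matrix.of_apply, Equiv.neg_apply, zpow_add₀ (h0 j), zpow_sub₀ (h0 j)]
  have hk : y j ^ (k + (N + 1) : ℤ) = κ := by
    rw [← hκ j, ← zpow_natCast]; push_cast; rfl
  split_ifs
  · rw [hk]; simp [div_eq_mul_inv]; ring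
  · simp [div_eq_mul_inv]

/-- The usual argument that eigenvectors for distinct eigenvalues are orthogonal: `wave k z⁻¹` is a
multiple of the reflection of `wave k z`, hence an eigenvector of the transpose of `T(u)` with the
eigenvalue belonging to `z`. -/
theorem prod_one_add_eq_of_dot_ne_zero {N k : ℕ} (hN : 1 ≤ N) {y z : Fin (N + 1) → ℂ}
    (hy : ∏ j, y j = 1) {κ : ℂ} (hκ : ∀ j, y j ^ (k + (N + 1)) = κ)
    (hz : ∏ j, z j = 1) {μ : ℂ} (hμ : ∀ j, z j ^ (k + (N + 1)) = μ)
    (h : dot (wave k z⁻¹) (wave k y) ≠ 0) (u : ℂ) :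
    ∏ j, (1 + u * (y j)⁻¹) = ∏ j, (1 + u * (z j)⁻¹) := by
  obtain ⟨c, hc, hc'⟩ := slater_rev hN hz hμ
  have hr : wave k z⁻¹ = c • reflect (wave k z) := by
    have hsm : ∀ (f : Weight N k → ℂ), c • toState f = toState fun m => c * f m := fun f => by
      simp [toState, Finset.smul_sum, smul_smul]
    rw [wave, wave, reflect_toState (fun m => slater z (pos m)), hsm]
    congr 1
    funext m
    exact hc' m.1 m.2
  obtain ⟨Y, hY, hYr⟩ := isTransp_opT (N := N) u
  have h1 := hY (wave k y) (wave k z⁻¹)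
  rw [opT_wave hN hy hκ, map_smul] at h1
  have h2 : Y (wave k z⁻¹) = (∏ j, (1 + u * (z j)⁻¹)) • wave k z⁻¹ := by
    rw [hr, map_smul, ← Module.End.mul_apply, hYr, Module.End.mul_apply, opT_wave hN hz hμ,
      map_smul, smul_comm]
  rw [h2, dot_smul, LinearMap.smul_apply] at h1
  exact mul_right_cancel₀ h h1

theorem exists_perm_of_prod_eq {n : ℕ} {a b : Fin n → ℂ} (ha : ∀ j, a j ≠ 0)
    (hinj : Function.Injective a)
    (h : ∀ u : ℂ, ∏ j, (1 + u * a j) = ∏ j, (1 + u * b j)) :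
    ∃ p : Equiv.Perm (Fin n), ∀ j, a j = b (p j) := by
  have hex : ∀ j, ∃ i, a j = b i := by
    intro j
    have h1 := h (-(a j)⁻¹)
    rw [Finset.prod_eq_zero (Finset.mem_univ j) (by rw [neg_mul, inv_mul_cancel₀ (ha j)]; ring),
      eq_comm, Finset.prod_eq_zero_iff] at h1
    obtain ⟨i, -, hi⟩ := h1
    refine ⟨i, ?_⟩
    have := ha j
    field_simp at hi
    linear_combination hi
  choose p hp using hex
  have hpi : Function.Injective p := fun i j hij => hinj (by rw [hp, hp, hij])
  exact ⟨Equiv.ofBijective p (Finite.injective_iff_bijective.mp hpi), hp⟩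

/-! ## The coefficients of `h_r(𝓐)` -/

theorem create_pow_apply {N : ℕ} (i : Fin (N + 1)) (e : ℕ) (f : State N)
    (m : Fin (N + 1) → ℕ) :
    (create i ^ e) f m = if e ≤ m i then f (m - Pi.single i e) else 0 := by
  induction e generalizing m with
  | zero => simp
  | succ e ih =>
    rw [pow_succ', Module.End.mul_apply, create_apply]
    by_cases h : 0 < m i
    · rw [if_pos h, ih]
      have h1 : e ≤ (m - Pi.single i 1 : Fin (N + 1) → ℕ) i ↔ e + 1 ≤ m i := by
        simp; omega
      have h2 : m - Pi.single i 1 - Pi.single i e = m - Pi.single i (e + 1) := by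
        rw [tsub_tsub, ← Pi.single_add, Nat.add_comm 1 e]
      simp only [h1, h2]
    · rw [if_neg h, if_neg (by omega)]

theorem annih_pow_apply {N : ℕ} (i : Fin (N + 1)) (e : ℕ) (f : State N)
    (m : Fin (N + 1) → ℕ) :
    (annih i ^ e) f m = f (m + Pi.single i e) := by
  induction e generalizing m with
  | zero => simp
  | succ e ih =>
    rw [pow_succ', Module.End.mul_apply, annih_apply, ih, add_assoc, ← Pi.single_add, add_comm 1]

theorem plac_pow_apply {N : ℕ} (j : Fin N) (e : ℕ) (f : State N) (m : Fin (N + 1) → ℕ) :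
    (plac j ^ e) f m = if e ≤ m j.succ then
      f (m - Pi.single j.succ e + Pi.single j.castSucc e) else 0 := by
  induction e generalizing m with
  | zero => simp
  | succ e ih =>
    rw [pow_succ', Module.End.mul_apply, plac_apply]
    have hne : j.succ ≠ j.castSucc := by simp [Fin.ext_iff]
    by_cases h : 0 < m j.succ
    · rw [if_pos h, ih]
      have h1 : e ≤ (m - Pi.single j.succ 1 + Pi.single j.castSucc 1 : Fin (N + 1) → ℕ) j.succ ↔
          e + 1 ≤ m j.succ := by
        simp [hne]; omega
      have h2 : m - Pi.single j.succ 1 + Pi.single j.castSucc 1 - Pi.single j.succ e +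
          Pi.single j.castSucc e = m - Pi.single j.succ (e + 1) + Pi.single j.castSucc (e + 1) := by
        funext i
        by_cases h3 : i = j.succ
        · subst h3; simp [hne]; omega
        · by_cases h4 : i = j.castSucc
          · subst h4; simp [hne.symm]; omega
          · simp [h3, h4]
      simp only [h1, h2]
    · rw [if_neg h, if_neg (by omega)]

theorem plac_pow_prod_apply {N : ℕ} (ε : Fin (N + 1) → ℕ) (f : State N)
    (m : Fin (N + 1) → ℕ) :
    (List.ofFn fun j : Fin N => plac j ^ ε j.succ).prod f m =
      if ∀ i, i ≠ 0 → ε i ≤ m i then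
        f (fun i => m i - (if i ≠ 0 then ε i else 0) + if i ≠ Fin.last N then ε (i + 1) else 0)
      else 0 := by
  set G : ℕ → Module.End ℂ (State N) := fun t => if h : t < N then
    plac ⟨t, h⟩ ^ ε (Fin.succ ⟨t, h⟩) else 1 with hG
  have h0 : (List.ofFn fun j : Fin N => plac j ^ ε j.succ) = List.ofFn fun j : Fin N => G j := by
    congr 1
    funext j
    simp only [hG, dif_pos j.2]
  rw [h0]
  -- On coefficients the leftmost factor is read first. When factor `t` is reached, label `t + 1` is
  -- still untouched, so the condition is `ε ≤ m` for the original labels.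
  have key : ∀ t, t ≤ N → ∀ f : State N, (List.ofFn fun j : Fin t => G j).prod f m =
      if ∀ i : Fin (N + 1), i ≠ 0 → (i : ℕ) ≤ t → ε i ≤ m i then
        f (fun i => m i - (if i ≠ 0 ∧ (i : ℕ) ≤ t then ε i else 0) +
          if (i : ℕ) < t then ε (i + 1) else 0)
      else 0 := by
    intro t
    induction t with
    | zero =>
      intro _ f
      have h1 : ∀ i : Fin (N + 1), i ≠ 0 → (i : ℕ) ≤ 0 → ε i ≤ m i := fun i hi hi' =>
        absurd (Fin.ext (by simpa using hi')) hi
      rw [if_pos h1]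
      simp
    | succ t ih =>
      intro ht f
      have htN : t < N := ht
      rw [List.ofFn_succ', List.concat_eq_append, List.prod_append, List.prod_singleton,
        Module.End.mul_apply]
      have e1 : (List.ofFn fun i : Fin t => G (i.castSucc : Fin (t + 1))) =
          List.ofFn fun i : Fin t => G i := rfl
      rw [e1, ih htN.le, Fin.val_last]
      simp only [hG, dif_pos htN]
      set s : Fin N := ⟨t, htN⟩ with hs
      have hsv : (s.succ : ℕ) = t + 1 := rfl
      have hst : (s : ℕ) = t := rfl
      rw [plac_pow_apply]
      have h3 : m s.succ - (if s.succ ≠ 0 ∧ (s.succ : ℕ) ≤ t then ε s.succ else 0) +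
          (if (s.succ : ℕ) < t then ε (s.succ + 1) else 0) = m s.succ := by
        rw [hsv, if_neg (by omega), if_neg (by omega)]
        rfl
      rw [h3]
      have h4 : (∀ i : Fin (N + 1), i ≠ 0 → (i : ℕ) ≤ t + 1 → ε i ≤ m i) ↔
          (∀ i : Fin (N + 1), i ≠ 0 → (i : ℕ) ≤ t → ε i ≤ m i) ∧ ε s.succ ≤ m s.succ := by
        constructor
        · exact fun h => ⟨fun i hi hi' => h i hi (by omega),
            h _ (Fin.succ_ne_zero s) (by rw [hsv])⟩
        · rintro ⟨h, h'⟩ i hi hi'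
          by_cases hit : (i : ℕ) ≤ t
          · exact h i hi hit
          · have : i = s.succ := Fin.ext (by rw [hsv]; omega)
            rw [this]; exact h'
      by_cases h5 : ∀ i : Fin (N + 1), i ≠ 0 → (i : ℕ) ≤ t → ε i ≤ m i
      swap
      · rw [if_neg h5, if_neg fun h => h5 (h4.mp h).1]
      rw [if_pos h5]
      by_cases h6 : ε s.succ ≤ m s.succ
      swap
      · rw [if_neg h6, if_neg fun h => h6 (h4.mp h).2]
      rw [if_pos h6, if_pos (h4.mpr ⟨h5, h6⟩)]
      congr 1
      funext i
      have hne : s.succ ≠ s.castSucc := by simp [Fin.ext_iff]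
      by_cases h7 : i = s.succ
      · subst h7
        simp [hst, hne]
      · have h7' : (i : ℕ) ≠ t + 1 := fun h => h7 (Fin.ext (by rw [hsv, h]))
        by_cases h8 : i = s.castSucc
        · subst h8
          have : s.castSucc + 1 = s.succ := Fin.coeSucc_eq_succ
          simp [hne.symm, this, hst]
        · have h8' : (i : ℕ) ≠ t := fun h => h8 (Fin.ext (by rw [h]; rfl))
          have h9 : (i : ℕ) ≤ t + 1 ↔ (i : ℕ) ≤ t := by omega
          have h10 : (i : ℕ) < t + 1 ↔ (i : ℕ) < t := by omega
          simp [h7, h8, h9, h10]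
  rw [key N le_rfl]
  have h1 : ∀ i : Fin (N + 1), (i : ℕ) ≤ N := fun i => Nat.lt_succ_iff.mp i.2
  have h2 : ∀ i : Fin (N + 1), (i : ℕ) < N ↔ i ≠ Fin.last N := fun i => by
    rw [← Fin.lt_last_iff_ne_last]; rfl
  simp only [h1, h2, and_true, true_implies]

/-- The labels obtained by moving `ε_i` particles from node `i` to node `i - 1`. -/
def moved {N : ℕ} (m ε : Fin (N + 1) → ℕ) : Fin (N + 1) → ℕ := fun i => m i - ε i + ε (i + 1)

theorem hOp_monomial_apply {N : ℕ} (ε : Fin (N + 1) → ℕ) (f : State N)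
    (m : Fin (N + 1) → ℕ) :
    (create 0 ^ ε 0 * (List.ofFn fun j : Fin N => plac j ^ ε j.succ).prod *
      annih (Fin.last N) ^ ε 0 : Module.End ℂ (State N)) f m = if ∀ i, ε i ≤ m i then f (moved m ε) else 0 := by
  rw [Module.End.mul_apply, Module.End.mul_apply, create_pow_apply]
  by_cases h0 : ε 0 ≤ m 0
  swap
  · rw [if_neg h0, if_neg fun h => h0 (h 0)]
  rw [if_pos h0, plac_pow_prod_apply]
  have h1 : (∀ i, i ≠ 0 → ε i ≤ (m - Pi.single 0 (ε 0) : Fin (N + 1) → ℕ) i) ↔ ∀ i, ε i ≤ m i := by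
    constructor
    · intro h i
      by_cases hi : i = 0
      · rw [hi]; exact h0
      · simpa [hi] using h i hi
    · intro h i hi
      simpa [hi] using h i
  simp only [h1]
  by_cases h2 : ∀ i, ε i ≤ m i
  swap
  · rw [if_neg h2, if_neg h2]
  rw [if_pos h2, if_pos h2, annih_pow_apply]
  congr 1
  funext i
  simp only [moved, Pi.add_apply, Pi.sub_apply]
  by_cases hi : i = 0
  · subst hi
    by_cases hl : (0 : Fin (N + 1)) = Fin.last N
    · rw [← hl]
      have : (0 : Fin (N + 1)) + 1 = 0 := by
        have := Fin.last_add_one N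
        rwa [← hl] at this
      rw [this]
      simp
    · simp [hl]
  · by_cases hl : i = Fin.last N
    · subst hl
      simp [hi]
    · simp [hi, hl]

theorem hOp_apply {N : ℕ} (r : ℕ) (f : State N) (m : Fin (N + 1) → ℕ) :
    hOp 1 r f m = ∑ ε ∈ Finset.piAntidiag (Finset.univ : Finset (Fin (N + 1))) r,
      if ∀ i, ε i ≤ m i then f (moved m ε) else 0 := by
  simp only [hOp, one_pow, one_smul]
  rw [LinearMap.sum_apply, Finsupp.finsetSum_apply]
  exact Finset.sum_congr rfl fun ε _ => hOp_monomial_apply ε f m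

/-- The common shift `ε 0` records the particles that pass the affine node. It is invisible to plane
waves by `slater_add_const`. -/
theorem pos_moved {N : ℕ} {m ε : Fin (N + 1) → ℕ} (h : ∀ i, ε i ≤ m i) (i : Fin (N + 1)) :
    pos (moved m ε) i = pos m i - ε i + ε 0 := by
  rw [pos_unique (l := fun i => pos m i - ε i + ε 0) 0, sub_zero]
  · have := h (Fin.last N)
    rw [pos_last, moved, Fin.last_add_one]
    omega
  · intro i
    have := h i.castSucc
    rw [pos_castSucc, moved, Fin.coeSucc_eq_succ]
    omega

theorem sum_moved {N : ℕ} {m ε : Fin (N + 1) → ℕ} (h : ∀ i, ε i ≤ m i) :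
    ∑ i, moved m ε i = ∑ i, m i := by
  have h1 := pos_zero (moved m ε)
  rw [pos_moved h, pos_zero] at h1
  omega

/-! ## Complete symmetric functions -/

/-- The generating function of the complete symmetric functions. -/
def hSeries {n : ℕ} (y : Fin n → ℂ) : PowerSeries ℂ := ∏ j, PowerSeries.mk fun r => y j ^ r

theorem one_sub_mul_mk (a : ℂ) :
    (1 - PowerSeries.C a * PowerSeries.X) * PowerSeries.mk (fun r => a ^ r) = 1 := by
  ext r
  rcases r with _ | r
  · simp [sub_mul, mul_assoc]
  · rw [sub_mul, one_mul, mul_assoc, map_sub, PowerSeries.coeff_C_mul,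
      PowerSeries.coeff_succ_X_mul, PowerSeries.coeff_mk, PowerSeries.coeff_mk,
      PowerSeries.coeff_one, if_neg (Nat.succ_ne_zero r), pow_succ']
    ring

theorem prod_one_sub_mul_hSeries {n : ℕ} (y : Fin n → ℂ) :
    (∏ j, (1 - PowerSeries.C (y j) * PowerSeries.X)) * hSeries y = 1 := by
  rw [hSeries, ← Finset.prod_mul_distrib]
  exact Finset.prod_eq_one fun j _ => one_sub_mul_mk (y j)

/-- The complete symmetric functions indexed by the integers. -/
def complete {n : ℕ} (y : Fin n → ℂ) (d : ℤ) : ℂ :=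
  if d < 0 then 0 else PowerSeries.coeff d.toNat (hSeries y)

theorem complete_neg {n : ℕ} (y : Fin n → ℂ) {d : ℤ} (h : d < 0) : complete y d = 0 := if_pos h

theorem complete_natCast {n : ℕ} (y : Fin n → ℂ) (d : ℕ) :
    complete y d = PowerSeries.coeff d (hSeries y) := by
  simp [complete]

theorem complete_zero {n : ℕ} (y : Fin n → ℂ) : complete y 0 = 1 := by
  simp [complete, hSeries, map_prod]

/-- Compare coefficients in `∏_{q ≠ p} (1 - y_q X) · H(X) = 1 / (1 - y_p X)`, where `H` generates
the complete symmetric functions. The polynomial has degree at most `N`, so only `N + 1` terms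
occur. -/
theorem pow_eq_sum_complete {N : ℕ} (y : Fin (N + 1) → ℂ) (p : Fin (N + 1)) (l : ℕ) :
    y p ^ l = ∑ j : Fin (N + 1), complete y (l - N + j) *
      (∏ q ∈ Finset.univ.erase p, (1 - Polynomial.C (y q) * Polynomial.X)).coeff (N - j) := by
  set P := ∏ q ∈ Finset.univ.erase p, (1 - Polynomial.C (y q) * Polynomial.X) with hP
  have hdeg : P.natDegree ≤ N := by
    refine (Polynomial.natDegree_prod_le _ _).trans ?_
    calc _ ≤ ∑ _q ∈ Finset.univ.erase p, 1 := by
          refine Finset.sum_le_sum fun q _ => ?_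
          refine (Polynomial.natDegree_sub_le _ _).trans ?_
          simpa using Polynomial.natDegree_C_mul_le (y q) Polynomial.X
      _ = N := by simp
  have hPH : (P : PowerSeries ℂ) * hSeries y = PowerSeries.mk fun r => y p ^ r := by
    have h1 := prod_one_sub_mul_hSeries y
    rw [← Finset.mul_prod_erase _ _ (Finset.mem_univ p)] at h1
    have h2 : (P : PowerSeries ℂ) =
        ∏ q ∈ Finset.univ.erase p, (1 - PowerSeries.C (y q) * PowerSeries.X) := by
      rw [hP, ← Polynomial.coeToPowerSeries.ringHom_apply, map_prod]
      simp
    rw [← h2, mul_assoc] at h1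
    have h3 := one_sub_mul_mk (y p)
    calc _ = ((1 - PowerSeries.C (y p) * PowerSeries.X) * PowerSeries.mk (fun r => y p ^ r)) *
        ((P : PowerSeries ℂ) * hSeries y) := by rw [h3, one_mul]
      _ = PowerSeries.mk (fun r => y p ^ r) * ((1 - PowerSeries.C (y p) * PowerSeries.X) *
        ((P : PowerSeries ℂ) * hSeries y)) := by ring
      _ = _ := by rw [h1, mul_one]
  have h4 := congrArg (PowerSeries.coeff l) hPH
  rw [PowerSeries.coeff_mk, PowerSeries.coeff_mul,
    Finset.Nat.sum_antidiagonal_eq_sum_range_succ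
      (fun a b => PowerSeries.coeff a (P : PowerSeries ℂ) * PowerSeries.coeff b (hSeries y))] at h4
  rw [← h4]
  -- Both sums are padded to a common range: the terms added here have a complete function of
  -- negative index, those in `h6` a coefficient beyond the degree.
  have h5 : ∑ a ∈ Finset.range (l + 1), PowerSeries.coeff a (P : PowerSeries ℂ) *
      PowerSeries.coeff (l - a) (hSeries y) =
      ∑ a ∈ Finset.range (l + 1 + N), P.coeff a * complete y (l - a) := by
    rw [← Finset.sum_subset (Finset.range_mono (show l + 1 ≤ l + 1 + N by omega))]
    · refine Finset.sum_congr rfl fun a ha => ?_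
      rw [Finset.mem_range] at ha
      rw [Polynomial.coeff_coe, ← complete_natCast, Nat.cast_sub (by omega)]
    · intro a _ ha
      rw [Finset.mem_range] at ha
      rw [complete_neg y (by omega), mul_zero]
  have h6 : ∑ a ∈ Finset.range (N + 1), P.coeff a * complete y (l - a) =
      ∑ a ∈ Finset.range (l + 1 + N), P.coeff a * complete y (l - a) := by
    refine Finset.sum_subset (Finset.range_mono (by omega)) fun a _ ha => ?_
    rw [Finset.mem_range] at ha
    rw [Polynomial.coeff_eq_zero_of_natDegree_lt (by omega), zero_mul]
  rw [h5, ← h6, Finset.sum_range, ← Equiv.sum_comp Fin.revPerm]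
  refine Finset.sum_congr rfl fun j _ => ?_
  have hj := Nat.lt_succ_iff.mp j.2
  rw [Fin.revPerm_apply, Fin.val_rev, Nat.add_sub_add_right, Nat.cast_sub hj, mul_comm]
  congr 2
  ring

/-- The Jacobi-Trudi formula. -/
theorem det_complete_mul_slater {N : ℕ} (y : Fin (N + 1) → ℂ) (l : Fin (N + 1) → ℤ)
    (hl : ∀ i, 0 ≤ l i) :
    (Matrix.of fun i j : Fin (N + 1) => complete y (l i - N + j)).det *
      slater y (fun i => N - i) = slater y l := by
  set E : Matrix (Fin (N + 1)) (Fin (N + 1)) ℂ := Matrix.of fun j p =>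
    (∏ q ∈ Finset.univ.erase p, (1 - Polynomial.C (y q) * Polynomial.X)).coeff (N - j) with hE
  have key : ∀ l : Fin (N + 1) → ℤ, (∀ i, 0 ≤ l i) →
      (Matrix.of fun i j : Fin (N + 1) => complete y (l i - N + j)).det * E.det = slater y l := by
    intro l hl
    rw [← Matrix.det_mul, slater]
    congr 1
    ext i p
    obtain ⟨a, ha⟩ := Int.eq_ofNat_of_zero_le (hl i)
    rw [Matrix.mul_apply, Matrix.of_apply, ha, zpow_natCast, pow_eq_sum_complete]
    simp [hE, ha]
  -- For `l = δ` the matrix of complete functions is unitriangular, which identifies `det E` with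
  -- the Vandermonde alternant.
  have h1 : (Matrix.of fun i j : Fin (N + 1) => complete y (((N : ℤ) - i) - N + j)).det = 1 := by
    rw [Matrix.det_of_isUpperTriangular]
    · refine Finset.prod_eq_one fun i _ => ?_
      rw [Matrix.of_apply, show ((N : ℤ) - i) - N + i = 0 by ring, complete_zero]
    · intro i j hij
      have : (j : ℕ) < i := hij
      rw [Matrix.of_apply, complete_neg]
      omega
  have h2 := key (fun i => N - i) fun i => by have := i.2; omega
  rw [h1, one_mul] at h2
  rw [← h2, key l hl]

/-! ## Plane waves are eigenvectors of `h_r(𝓐)` -/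

theorem det_eq_zero_of_row_eq_smul {n R : Type*} [DecidableEq n] [Fintype n] [CommRing R]
    {M : Matrix n n R} {i j : n} (hij : i ≠ j) (c : R) (h : M i = c • M j) : M.det = 0 := by
  have : M = M.updateRow i (c • M j) := by rw [← h, Matrix.updateRow_eq_self]
  rw [this, Matrix.det_updateRow_smul, Matrix.det_updateRow_eq_zero hij.symm, mul_zero]

theorem eq_univ_of_succ_mem {N : ℕ} {S : Finset (Fin (N + 1))} (hS : S.Nonempty)
    (h : ∀ i, i + 1 ∈ S → i ∈ S) : S = Finset.univ := by
  obtain ⟨s, hs⟩ := hS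
  have h0 : ∀ i, i ∈ S → 0 ∈ S := fun i => by
    induction i using Fin.induction with
    | zero => exact id
    | succ i ih => exact fun hi => ih (h _ (by rwa [Fin.coeSucc_eq_succ]))
  refine Finset.eq_univ_of_forall fun i => ?_
  induction i using Fin.reverseInduction with
  | last => exact h _ (by rw [Fin.last_add_one]; exact h0 s hs)
  | cast i ih => exact h _ (by rwa [Fin.coeSucc_eq_succ])

/-- A cyclically bidiagonal combination of rows changes a determinant only in high degree. -/
theorem det_sub_cyclic {N : ℕ} {R : Type*} [CommRing R] (x : R)
    (e : Fin (N + 1) → ℕ) (a b : Fin (N + 1) → Fin (N + 1) → R)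
    (c : Fin (N + 1) → R) (hb : ∀ i, b i = c i • a (i + 1)) :
    ∃ Z, (Matrix.of fun i j => a i j - x ^ e i * b i j).det =
      (Matrix.of a).det + x ^ (∑ i, e i) * Z := by
  set b' : Fin (N + 1) → Fin (N + 1) → R := fun i => (-(x ^ e i)) • b i with hb'
  have h1 : (Matrix.of fun i j => a i j - x ^ e i * b i j) = a + b' := by
    ext i j
    simp [hb', sub_eq_add_neg]
  have h2 := (Matrix.detRowAlternating (n := Fin (N + 1)) (R := R)).toMultilinearMap.map_add_univ a b'
  have h3 : (∏ i, (-(x ^ e i))) = (-1) ^ (N + 1) * x ^ (∑ i, e i) := by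
    rw [Finset.prod_neg, Finset.prod_pow_eq_pow_sum]; simp
  have h4 : (Matrix.detRowAlternating (n := Fin (N + 1)) (R := R)) b' =
      x ^ (∑ i, e i) * ((-1) ^ (N + 1) * (Matrix.detRowAlternating (n := Fin (N + 1)) (R := R)) b) := by
    rw [hb', AlternatingMap.map_smul_univ, h3, smul_eq_mul]
    ring
  refine ⟨(-1) ^ (N + 1) * (Matrix.detRowAlternating (n := Fin (N + 1)) (R := R)) b, ?_⟩
  rw [h1, ← h4]
  change (Matrix.detRowAlternating (n := Fin (N + 1)) (R := R)).toMultilinearMap (a + b') = _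
  rw [h2, Finset.sum_eq_add_of_mem Finset.univ ∅ (Finset.mem_univ _) (Finset.mem_univ _)
    Finset.univ_nonempty.ne_empty]
  · rw [Finset.piecewise_univ, Finset.piecewise_empty]
    rfl
  · rintro S - ⟨hS1, hS2⟩
    -- In a mixed term of the multilinear expansion some row `i` comes from `b'` while row `i + 1`
    -- comes from `a`; these rows are proportional, so only the two pure terms survive.
    have : ∃ i, i + 1 ∈ S ∧ i ∉ S := by
      by_contra! hcon
      exact hS1 (eq_univ_of_succ_mem (Finset.nonempty_iff_ne_empty.mpr hS2) hcon)
    obtain ⟨i, hi, hi'⟩ := this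
    have hne : i ≠ i + 1 := fun h => hi' (h ▸ hi)
    refine det_eq_zero_of_row_eq_smul (M := S.piecewise a b') hne (-(x ^ e i) * c i) ?_
    rw [Finset.piecewise_eq_of_notMem _ _ _ hi', Finset.piecewise_eq_of_mem _ _ _ hi, hb', mul_smul,
      ← hb]

theorem geom_aux (a : ℂ) (ha : a ≠ 0) (l : ℤ) (n : ℕ) :
    (1 - PowerSeries.C a⁻¹ * PowerSeries.X) *
      ∑ e ∈ Finset.range n, PowerSeries.X ^ e * PowerSeries.C (a ^ (l - e)) =
    PowerSeries.C (a ^ l) - PowerSeries.X ^ n * PowerSeries.C (a ^ (l - n)) := by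
  induction n with
  | zero => simp
  | succ n ih =>
    rw [Finset.sum_range_succ, mul_add, ih]
    have : PowerSeries.C (a ^ (l - (n + 1 : ℕ))) =
        PowerSeries.C a⁻¹ * PowerSeries.C (a ^ (l - n)) := by
      rw [← map_mul, ← zpow_neg_one, ← zpow_add₀ ha]
      congr 2
      push_cast
      ring
    rw [this]
    ring

/-- A Pieri rule on the circle, by generating functions. The sums over all `r` form a determinant of
truncated geometric series in `X`. Multiplying column `j` by `1 - X / y_j` telescopes them to `y ^
pos_i - X ^ (m_i + 1) y ^ pos_{i+1}` with cyclic index, and `det_sub_cyclic` says that the second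
terms contribute only from degree `∑ (m_i + 1) = k + n` on. -/
theorem sum_slater_sub {N k : ℕ} {y : Fin (N + 1) → ℂ} (hy : ∏ j, y j = 1) {κ : ℂ}
    (hκ : ∀ j, y j ^ (k + (N + 1)) = κ) {r : ℕ} (hr : r < k + (N + 1))
    (m : Fin (N + 1) → ℕ) (hm : ∑ i, m i = k) :
    (∑ ε ∈ Finset.piAntidiag (Finset.univ : Finset (Fin (N + 1))) r,
      if ∀ i, ε i ≤ m i then slater y (fun i => pos m i - ε i) else 0) =
    complete y⁻¹ r * slater y (pos m) := by
  have h0 : ∀ j, y j ≠ 0 := fun j h => by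
    rw [Finset.prod_eq_zero (Finset.mem_univ j) h] at hy
    exact zero_ne_one hy
  have hκ0 : κ ≠ 0 := by rw [← hκ 0]; exact pow_ne_zero _ (h0 0)
  set D : PowerSeries ℂ := (Matrix.of fun i j => ∑ e ∈ Finset.range (m i + 1),
    PowerSeries.X ^ e * PowerSeries.C (y j ^ (pos m i - e))).det with hD
  have hC : ∀ l : Fin (N + 1) → ℤ, (Matrix.of fun i j => PowerSeries.C (y j ^ l i)).det =
      PowerSeries.C (slater y l) := by
    intro l
    rw [slater, RingHom.map_det]
    rfl
  -- the coefficients of `D`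
  have h1 : PowerSeries.coeff r D = ∑ ε ∈ Finset.piAntidiag (Finset.univ : Finset (Fin (N + 1))) r,
      if ∀ i, ε i ≤ m i then slater y (fun i => pos m i - ε i) else 0 := by
    have h2 := (Matrix.detRowAlternating (n := Fin (N + 1))
      (R := PowerSeries ℂ)).toMultilinearMap.map_sum_finset
      (fun i (e : ℕ) => (PowerSeries.X ^ e : PowerSeries ℂ) •
        fun j => PowerSeries.C (y j ^ (pos m i - e))) (fun i => Finset.range (m i + 1))
    have h3 : D = (Matrix.detRowAlternating (n := Fin (N + 1))
      (R := PowerSeries ℂ)).toMultilinearMap (fun i => ∑ e ∈ Finset.range (m i + 1),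
        (PowerSeries.X ^ e : PowerSeries ℂ) • fun j => PowerSeries.C (y j ^ (pos m i - e))) := by
      rw [hD]
      change Matrix.det _ = Matrix.det _
      congr 1
      ext1 i j
      simp [Finset.sum_apply]
    have h4 : ∀ ε : Fin (N + 1) → ℕ, (Matrix.detRowAlternating (n := Fin (N + 1))
      (R := PowerSeries ℂ)).toMultilinearMap (fun i => (PowerSeries.X ^ ε i : PowerSeries ℂ) •
        fun j => PowerSeries.C (y j ^ (pos m i - ε i))) =
        PowerSeries.X ^ (∑ i, ε i) * PowerSeries.C (slater y fun i => pos m i - ε i) := by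
      intro ε
      rw [MultilinearMap.map_smul_univ, Finset.prod_pow_eq_pow_sum, smul_eq_mul, ← hC]
      rfl
    rw [h3, h2, map_sum]
    simp only [h4]
    have h5 : ∀ ε : Fin (N + 1) → ℕ, PowerSeries.coeff r (PowerSeries.X ^ (∑ i, ε i) *
        PowerSeries.C (slater y fun i => pos m i - ε i)) =
        if ∑ i, ε i = r then slater y (fun i => pos m i - ε i) else 0 := by
      intro ε
      rw [PowerSeries.coeff_mul_C, PowerSeries.coeff_X_pow]
      simp only [ite_mul, one_mul, zero_mul, eq_comm]
    simp only [h5]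
    rw [← Finset.sum_filter, ← Finset.sum_filter]
    refine Finset.sum_congr ?_ fun _ _ => rfl
    ext ε
    simp [Fintype.mem_piFinset, and_comm]
  -- `D` up to high degree
  have h6 : (∏ j, (1 - PowerSeries.C (y⁻¹ j) * PowerSeries.X)) * D =
      (Matrix.of fun i j => PowerSeries.C (y j ^ pos m i) - PowerSeries.X ^ (m i + 1) *
        PowerSeries.C (y j ^ (pos m i - (m i + 1 : ℕ)))).det := by
    rw [hD, ← Matrix.det_mul_row]
    congr 1
    ext1 i j
    rw [Matrix.of_apply, Matrix.of_apply, Matrix.of_apply, Pi.inv_apply, geom_aux _ (h0 j)]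
  -- Position `pos m i - (m i + 1)` is that of the next particle. After the last one it is `-1`, and
  -- `y⁻¹ = κ⁻¹ y ^ (k + N)` is `κ⁻¹` times row `0`.
  obtain ⟨Z, hZ⟩ := det_sub_cyclic (PowerSeries.X : PowerSeries ℂ) (fun i => m i + 1)
    (fun i j => PowerSeries.C (y j ^ pos m i))
    (fun i j => PowerSeries.C (y j ^ (pos m i - (m i + 1 : ℕ))))
    (fun i => if i = Fin.last N then PowerSeries.C κ⁻¹ else 1) (fun i => by
      funext j
      rw [Pi.smul_apply, smul_eq_mul]
      induction i using Fin.lastCases with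
      | last =>
        rw [if_pos rfl, Fin.last_add_one, pos_zero, pos_last, hm, ← map_mul, ← hκ j,
          ← zpow_natCast, ← zpow_neg, ← zpow_add₀ (h0 j)]
        congr 2
        push_cast
        ring
      | cast i =>
        rw [if_neg (Fin.castSucc_lt_last i).ne, Fin.coeSucc_eq_succ, one_mul, pos_castSucc]
        congr 2
        push_cast
        ring)
  have hsum : ∑ i, (m i + 1) = k + (N + 1) := by
    rw [Finset.sum_add_distrib, hm]; simp
  rw [hC, hsum] at hZ
  rw [hZ] at h6
  have h7 : D = hSeries y⁻¹ * (PowerSeries.C (slater y (pos m)) +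
      PowerSeries.X ^ (k + (N + 1)) * Z) := by
    rw [← h6, ← mul_assoc, mul_comm (hSeries _), prod_one_sub_mul_hSeries, one_mul]
  rw [← h1, h7, mul_add, map_add, PowerSeries.coeff_mul_C, complete_natCast, mul_left_comm,
    PowerSeries.coeff_X_pow_mul', if_neg (by omega), add_zero]

theorem hOp_wave {N k : ℕ} {y : Fin (N + 1) → ℂ} (hy : ∏ j, y j = 1) {κ : ℂ}
    (hκ : ∀ j, y j ^ (k + (N + 1)) = κ) {r : ℕ} (hr : r < k + (N + 1)) :
    hOp 1 r (wave k y) = complete y⁻¹ r • wave k y := by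
  ext m
  rw [hOp_apply, Finsupp.smul_apply, wave_apply, smul_eq_mul]
  by_cases hm : ∑ i, m i = k
  · rw [if_pos hm, ← sum_slater_sub hy hκ hr m hm]
    refine Finset.sum_congr rfl fun ε _ => ?_
    split_ifs with h
    · rw [wave_apply, sum_moved h, if_pos hm, funext (pos_moved h), slater_add_const hy]
    · rfl
  · rw [if_neg hm, mul_zero]
    refine Finset.sum_eq_zero fun ε _ => ?_
    split_ifs with h
    · rw [wave_apply, sum_moved h, if_neg hm]
    · rfl

theorem hOp_wave_of_lt {N k : ℕ} (y : Fin (N + 1) → ℂ) {r : ℕ} (hr : k < r) :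
    hOp 1 r (wave k y) = 0 := by
  ext m
  rw [hOp_apply, Finsupp.zero_apply]
  refine Finset.sum_eq_zero fun ε hε => ?_
  rw [Finset.mem_piAntidiag] at hε
  split_ifs with h
  · rw [wave_apply, sum_moved h, if_neg]
    rintro rfl
    have := Finset.sum_le_sum fun i (_ : i ∈ Finset.univ) => h i
    rw [← hε.1] at hr
    exact absurd this (not_le.mpr hr)
  · rfl

theorem exists_hOp_wave {N k : ℕ} {y : Fin (N + 1) → ℂ} (hy : ∏ j, y j = 1) {κ : ℂ}
    (hκ : ∀ j, y j ^ (k + (N + 1)) = κ) (r : ℕ) :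
    ∃ a : ℂ, hOp 1 r (wave k y) = a • wave k y := by
  by_cases h : r < k + (N + 1)
  · exact ⟨_, hOp_wave hy hκ h⟩
  · exact ⟨0, by rw [hOp_wave_of_lt y (by omega), zero_smul]⟩

/-! ## The affine plactic Schur polynomials -/

theorem list_prod_apply_of_eigen {V : Type*} [AddCommGroup V] [Module ℂ V] {n : ℕ}
    (X : Fin n → Module.End ℂ V) (a : Fin n → ℂ) (v : V) (h : ∀ i, X i v = a i • v) :
    (List.ofFn X).prod v = (∏ i, a i) • v := by
  induction n with
  | zero => simp
  | succ n ih =>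
    rw [List.ofFn_succ, List.prod_cons, Module.End.mul_apply,
      ih (fun i => X i.succ) (fun i => a i.succ) fun i => h i.succ, map_smul, h, smul_smul,
      Fin.prod_univ_succ, mul_comm]

theorem part_le {N k : ℕ} (l : Weight N k) (i : Fin (N + 1)) : part l.1 i ≤ k := by
  calc part l.1 i ≤ ∑ j, l.1 j := Finset.sum_le_sum_of_subset (Finset.filter_subset _ _)
    _ = k := l.2

theorem pos_eq_part {N : ℕ} (m : Fin (N + 1) → ℕ) (i : Fin (N + 1)) :
    pos m i = part m i + m (Fin.last N) + (N - i) := by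
  have h1 : (Finset.univ.filter fun j : Fin (N + 1) => i ≤ j) = insert (Fin.last N)
      (Finset.univ.filter fun j : Fin (N + 1) => i ≤ j ∧ j ≠ Fin.last N) := by
    ext j
    simp only [Finset.mem_filter, Finset.mem_univ, true_and, Finset.mem_insert]
    constructor
    · intro h
      by_cases hj : j = Fin.last N
      · exact Or.inl hj
      · exact Or.inr ⟨h, hj⟩
    · rintro (rfl | h)
      · exact Fin.le_last i
      · exact h.1
  rw [pos, h1, Finset.sum_insert (by simp), part]
  push_cast
  ring

theorem part_last {N : ℕ} (m : Fin (N + 1) → ℕ) : part m (Fin.last N) = 0 := by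
  have h1 := pos_eq_part m (Fin.last N)
  rw [pos_last, Fin.val_last] at h1
  omega

/-- The Schur function as a ratio of alternants. -/
def schurVal {N k : ℕ} (y : Fin (N + 1) → ℂ) (l : Weight N k) : ℂ :=
  (Matrix.of fun i j : Fin (N + 1) => complete y (part l.1 i - i + j)).det

theorem schurVal_mul_slater {N k : ℕ} {y : Fin (N + 1) → ℂ} (hy : ∏ j, y j = 1)
    (l : Weight N k) :
    schurVal y l * slater y (fun i => N - i) = slater y (pos l.1) := by
  have h1 := det_complete_mul_slater y (fun i => part l.1 i + (N - i)) fun i => by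
    have := i.2; omega
  rw [schurVal]
  have h2 : (fun i => pos l.1 i) = fun i : Fin (N + 1) =>
      ((part l.1 i : ℤ) + (N - i)) + l.1 (Fin.last N) := by
    funext i; rw [pos_eq_part]; ring
  rw [show pos l.1 = fun i => pos l.1 i from rfl, h2, slater_add_const hy, ← h1]
  congr 3
  ext i j
  congr 1
  ring

/-- Because the last part is zero, the last row of the `n × n` determinant is `(0, …, 0, 1)`, and
expansion along it leaves the `(n - 1) × (n - 1)` determinant that defines the Schur operator. -/
theorem sum_perm_complete {N k : ℕ} (y : Fin (N + 1) → ℂ) (l : Weight N k) :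
    ∑ w : Equiv.Perm (Fin N), (Equiv.Perm.sign w : ℤ) •
      ∏ i : Fin N, complete y ((l.toPart i : ℤ) - i + w i) = schurVal y l := by
  have h1 : ∑ w : Equiv.Perm (Fin N), (Equiv.Perm.sign w : ℤ) •
      ∏ i : Fin N, complete y ((l.toPart i : ℤ) - i + w i) =
      (Matrix.of fun i j : Fin N => complete y ((l.toPart i : ℤ) - i + j)).det := by
    rw [← Matrix.det_transpose, Matrix.det_apply]
    rfl
  rw [h1, schurVal, Matrix.det_succ_row _ (Fin.last N), Finset.sum_eq_single (Fin.last N)]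
  · rw [Matrix.of_apply, part_last]
    have : ((0 : ℕ) : ℤ) - (Fin.last N : ℕ) + (Fin.last N : ℕ) = 0 := by push_cast; ring
    rw [this, complete_zero, ← two_mul, pow_mul, neg_one_sq, one_pow, one_mul, one_mul]
    congr 1
    ext i j
    simp [Weight.toPart, Fin.succAbove_last]
  · intro j _ hj
    have : (j : ℕ) < N := Fin.val_lt_last hj
    rw [Matrix.of_apply, part_last, complete_neg, mul_zero, zero_mul]
    rw [Fin.val_last]
    omega
  · simp

/-- The indices in the determinant can exceed `k`, but they are at most `k + N - 1`, within the
range `r < k + n` in which the eigenvalue of `h_r(𝓐)` is known to be a complete symmetric function.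
-/
theorem schurOp_wave {N k : ℕ} {y : Fin (N + 1) → ℂ} (hy : ∏ j, y j = 1) {κ : ℂ}
    (hκ : ∀ j, y j ^ (k + (N + 1)) = κ) (l : Weight N k) :
    schurOp 1 l.toPart (wave k y) = schurVal y⁻¹ l • wave k y := by
  rw [← sum_perm_complete, schurOp, LinearMap.sum_apply, Finset.sum_smul]
  refine Finset.sum_congr rfl fun w _ => ?_
  rw [LinearMap.smul_apply, smul_assoc, list_prod_apply_of_eigen _
    (fun i : Fin N => complete y⁻¹ ((l.toPart i : ℤ) - i + w i))]
  intro i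
  rw [hOpInt]
  have h1 : l.toPart i ≤ k := part_le l _
  have h2 := (w i).2
  split_ifs with h
  · rw [hOp_wave hy hκ (by omega), Int.toNat_of_nonneg h]
  · rw [complete_neg _ (by omega), zero_smul, LinearMap.zero_apply]

/-! ## The roots attached to a weight -/

theorem sum_rhoShift {N : ℕ} (m : Fin (N + 1) → ℕ) : ∑ i, rhoShift m i = 0 := by
  simp only [rhoShift, Finset.sum_add_distrib, Finset.sum_sub_distrib, Finset.sum_const,
    Finset.card_univ, Fintype.card_fin, nsmul_eq_mul]
  have h1 : (∑ i : Fin (N + 1), ((i : ℕ) : ℝ)) * 2 = (N + 1) * N := by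
    rw [Fin.sum_univ_eq_sum_range (fun i => (i : ℝ))]
    have := Finset.sum_range_id_mul_two (N + 1)
    rw [Nat.add_sub_cancel] at this
    have h := congrArg (Nat.cast : ℕ → ℝ) this
    push_cast at h
    exact h
  have h2 : ∑ i : Fin (N + 1), (part m i : ℝ) = size m := by
    rw [size]; push_cast; rfl
  rw [h2]
  push_cast
  field_simp
  linarith

/-- The shift between particle positions and the coordinates of `λ + ρ`. -/
def rhoConst {N : ℕ} (m : Fin (N + 1) → ℕ) : ℝ :=
  m (Fin.last N) + (size m : ℝ) / (N + 1) + (N : ℝ) / 2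

theorem rhoShift_eq {N : ℕ} (m : Fin (N + 1) → ℕ) (i : Fin (N + 1)) :
    rhoShift m i = pos m i - rhoConst m := by
  rw [pos_eq_part, rhoShift, rhoConst]
  push_cast
  ring

theorem pos_le {N : ℕ} (m : Fin (N + 1) → ℕ) (i : Fin (N + 1)) :
    pos m i ≤ (∑ j, m j : ℕ) + (N - i) := by
  rw [pos]
  have := Finset.sum_le_sum_of_subset (f := m) (Finset.filter_subset (fun j => i ≤ j) Finset.univ)
  have h : (∑ j with i ≤ j, (m j : ℤ)) ≤ (∑ j, m j : ℕ) := by exact_mod_cast this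
  omega

theorem pos_nonneg {N : ℕ} (m : Fin (N + 1) → ℕ) (i : Fin (N + 1)) : 0 ≤ pos m i := by
  rw [pos]
  have h : 0 ≤ (∑ j with i ≤ j, (m j : ℤ)) := Finset.sum_nonneg fun j _ => by positivity
  have := i.2
  omega

theorem pos_strictAnti {N : ℕ} (m : Fin (N + 1) → ℕ) : StrictAnti (pos m) :=
  Fin.strictAnti_iff_succ_lt.mpr fun i => by
    rw [pos_castSucc]; omega

theorem pos_injective {N k : ℕ} {s t : Weight N k}
    (h : ∀ i, rhoShift s.1 i = rhoShift t.1 i) : s = t := by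
  have h1 : ∀ i : Fin N, s.1 i.castSucc = t.1 i.castSucc := by
    intro i
    have e1 := h i.castSucc
    have e2 := h i.succ
    rw [rhoShift_eq, rhoShift_eq, pos_castSucc, pos_castSucc] at e1
    rw [rhoShift_eq, rhoShift_eq] at e2
    push_cast at e1
    have : (s.1 i.castSucc : ℝ) = t.1 i.castSucc := by linarith
    exact_mod_cast this
  have h2 := s.2
  have h3 := t.2
  rw [Fin.sum_univ_castSucc] at h2 h3
  simp only [h1] at h2
  refine Subtype.ext (funext fun i => ?_)
  induction i using Fin.lastCases with
  | last => omega
  | cast i => exact h1 i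

/-- The primitive root of unity `exp (2πi / (k + n))`. -/
def zetaRoot (N k : ℕ) : ℂ := Complex.exp (2 * Real.pi * Complex.I / ((k : ℂ) + (N + 1)))

theorem isPrimitiveRoot_zetaRoot (N k : ℕ) : IsPrimitiveRoot (zetaRoot N k) (k + (N + 1)) := by
  have := Complex.isPrimitiveRoot_exp (k + (N + 1)) (by omega)
  push_cast at this
  exact this

theorem level_ne_zero (N k : ℕ) : (k : ℂ) + (N + 1) ≠ 0 := by
  have : ((k + (N + 1) : ℕ) : ℂ) ≠ 0 := Nat.cast_ne_zero.mpr (by omega)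
  exact_mod_cast this

/-- The exponentials of the coordinates of `σ + ρ`. -/
def rootY {N k : ℕ} (s : Weight N k) (j : Fin (N + 1)) : ℂ :=
  Complex.exp (2 * Real.pi * Complex.I / ((k : ℂ) + (N + 1)) * (rhoShift s.1 j : ℝ))

/-- The common phase of the roots of a weight. -/
def phase {N k : ℕ} (s : Weight N k) : ℂ :=
  Complex.exp (2 * Real.pi * Complex.I / ((k : ℂ) + (N + 1)) *
    ((s.1 (Fin.last N) : ℂ) - (rhoConst s.1 : ℝ)))

theorem rootY_eq {N k : ℕ} (s : Weight N k) (j : Fin (N + 1)) :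
    rootY s j = zetaRoot N k ^ (part s.1 j + (N - j)) * phase s := by
  have hj : (j : ℕ) ≤ N := Nat.lt_succ_iff.mp j.2
  rw [rootY, rhoShift_eq, pos_eq_part, zetaRoot, phase, ← Complex.exp_nat_mul, ← Complex.exp_add]
  congr 1
  push_cast [Nat.cast_sub hj]
  ring

theorem prod_rootY {N k : ℕ} (s : Weight N k) : ∏ j, rootY s j = 1 := by
  simp only [rootY]
  rw [← Complex.exp_sum, ← Finset.mul_sum, ← Complex.ofReal_sum, sum_rhoShift]
  simp

theorem rootY_ne_zero {N k : ℕ} (s : Weight N k) (j : Fin (N + 1)) : rootY s j ≠ 0 :=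
  Complex.exp_ne_zero _

theorem rootY_pow {N k : ℕ} (s : Weight N k) (j : Fin (N + 1)) :
    rootY s j ^ (k + (N + 1)) = phase s ^ (k + (N + 1)) := by
  rw [rootY_eq, mul_pow, ← pow_mul, mul_comm, pow_mul', (isPrimitiveRoot_zetaRoot N k).pow_eq_one,
    one_pow, mul_one]

theorem prod_rootY_inv {N k : ℕ} (s : Weight N k) : ∏ j, (rootY s)⁻¹ j = 1 := by
  simp only [Pi.inv_apply]
  rw [Finset.prod_inv_distrib, prod_rootY, inv_one]

theorem rhoShift_sub_lt {N k : ℕ} (s : Weight N k) (i j : Fin (N + 1)) :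
    rhoShift s.1 i - rhoShift s.1 j < k + (N + 1) := by
  rw [rhoShift_eq, rhoShift_eq]
  have h1 := pos_le s.1 i
  have h2 := pos_nonneg s.1 j
  rw [s.2] at h1
  have h3 : ((pos s.1 i - pos s.1 j : ℤ) : ℝ) < ((k + (N + 1) : ℤ) : ℝ) := by
    exact_mod_cast (by omega : pos s.1 i - pos s.1 j < k + (N + 1))
  push_cast at h3
  linarith

theorem rhoShift_strictAnti {N k : ℕ} (s : Weight N k) : StrictAnti (rhoShift s.1) := by
  intro i j hij
  rw [rhoShift_eq, rhoShift_eq]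
  have : (pos s.1 j : ℝ) < pos s.1 i := by exact_mod_cast pos_strictAnti s.1 hij
  linarith

theorem exists_int_of_rootY_eq {N k : ℕ} {s t : Weight N k} {i j : Fin (N + 1)}
    (h : rootY s i = rootY t j) :
    ∃ c : ℤ, rhoShift s.1 i = rhoShift t.1 j + c * (k + (N + 1)) := by
  rw [rootY, rootY, Complex.exp_eq_exp_iff_exists_int] at h
  obtain ⟨c, hc⟩ := h
  refine ⟨c, ?_⟩
  have hK := level_ne_zero N k
  have hpi : (2 * Real.pi * Complex.I : ℂ) ≠ 0 := Complex.two_pi_I_ne_zero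
  have h1 : ((rhoShift s.1 i : ℝ) : ℂ) = ((rhoShift t.1 j + c * (k + (N + 1)) : ℝ) : ℂ) := by
    push_cast
    apply mul_left_cancel₀ (div_ne_zero hpi hK)
    rw [hc]
    field_simp
  exact_mod_cast h1

theorem rootY_injective {N k : ℕ} (s : Weight N k) : Function.Injective (rootY s) := by
  intro i j h
  obtain ⟨c, hc⟩ := exists_int_of_rootY_eq h
  have h1 := rhoShift_sub_lt s i j
  have h2 := rhoShift_sub_lt s j i
  have hK : (0 : ℝ) < k + (N + 1) := by positivity
  have h3 : c < 1 := by
    have : (c : ℝ) < 1 := by nlinarith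
    exact_mod_cast this
  have h4 : -1 < c := by
    have : (-1 : ℝ) < c := by nlinarith
    exact_mod_cast this
  have h5 : c = 0 := by omega
  rw [h5] at hc
  exact (rhoShift_strictAnti s).injective (by simpa using hc)

/-- A weight is determined by its roots up to order. -/
theorem eq_of_rootY_perm {N k : ℕ} {s t : Weight N k} (p : Equiv.Perm (Fin (N + 1)))
    (h : ∀ j, rootY s j = rootY t (p j)) : s = t := by
  choose c hc using fun j => exists_int_of_rootY_eq (h j)
  have hK : (0 : ℝ) < k + (N + 1) := by positivity
  have hsum : ∑ j, (c j : ℝ) = 0 := by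
    have h1 := sum_rhoShift s.1
    simp only [hc] at h1
    rw [Finset.sum_add_distrib, Equiv.sum_comp p (rhoShift t.1), sum_rhoShift, zero_add,
      ← Finset.sum_mul] at h1
    exact (mul_eq_zero.mp h1).resolve_right hK.ne'
  have hsum' : ∑ j, c j = 0 := by exact_mod_cast hsum
  -- The coordinates of each shifted weight spread over less than `k + n`, so the windings `c`
  -- differ by at most one; as they sum to zero, they all vanish.
  have hle : ∀ i j, c i ≤ c j + 1 := by
    intro i j
    have h1 := rhoShift_sub_lt s i j
    have h2 := rhoShift_sub_lt t (p j) (p i)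
    rw [hc i, hc j] at h1
    have : (c i : ℝ) < c j + 2 := by nlinarith
    have : c i < c j + 2 := by exact_mod_cast this
    omega
  have hzero : ∀ i, c i = 0 := by
    by_contra! hne
    obtain ⟨i, hi⟩ := hne
    rcases lt_or_gt_of_ne hi with hlt | hgt
    · have : ∑ j, c j < 0 := Finset.sum_neg' (fun j _ => by have := hle j i; omega)
        ⟨i, Finset.mem_univ i, hlt⟩
      omega
    · have : 0 < ∑ j, c j := Finset.sum_pos' (fun j _ => by have := hle i j; omega)
        ⟨i, Finset.mem_univ i, hgt⟩
      omega
  have h1 : ∀ j, rhoShift s.1 j = rhoShift t.1 (p j) := fun j => by rw [hc, hzero]; simp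
  -- Both families of coordinates are strictly decreasing, so the permutation preserves order and is
  -- the identity.
  have hp : StrictMono p := fun i j hij => by
    have := rhoShift_strictAnti s hij
    rw [h1, h1] at this
    exact (rhoShift_strictAnti t).lt_iff_gt.mp this
  have hp1 : ∀ j, p j = j := fun j => by
    have := Subsingleton.elim (hp.orderIsoOfSurjective p p.surjective) (OrderIso.refl _)
    exact DFunLike.congr_fun this j
  exact pos_injective fun i => by rw [h1, hp1]

theorem slater_delta_ne_zero {N : ℕ} {y : Fin (N + 1) → ℂ} (hy : Function.Injective y) :
    slater y (fun i => N - i) ≠ 0 := by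
  have h1 := Matrix.det_permute Fin.revPerm (Matrix.vandermonde y).transpose
  have h2 : (Matrix.of fun i j : Fin (N + 1) => y j ^ ((N : ℤ) - i)) =
      (Matrix.vandermonde y).transpose.submatrix Fin.revPerm id := by
    ext i j
    have hi : (i : ℕ) ≤ N := Nat.lt_succ_iff.mp i.2
    simp only [Matrix.of_apply, Matrix.submatrix_apply, Matrix.transpose_apply,
      Matrix.vandermonde_apply, Fin.revPerm_apply, Fin.val_rev, id, ← zpow_natCast]
    congr 1
    omega
  rw [slater, h2, h1, Matrix.det_transpose]
  refine mul_ne_zero ?_ (Matrix.det_vandermonde_ne_zero_iff.mpr hy)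
  exact_mod_cast (Equiv.Perm.sign _).ne_zero

/-! ## The modular `S`-matrix -/

theorem modularS_symm {N k : ℕ} (l s : Weight N k) : modularS N k l s = modularS N k s l := by
  rw [modularS, modularS]
  congr 1
  rw [← Equiv.sum_comp (Equiv.inv (Equiv.Perm (Fin (N + 1))))]
  refine Finset.sum_congr rfl fun w _ => ?_
  rw [Equiv.inv_apply, Equiv.Perm.sign_inv, inv_inv]
  congr 4
  rw [← Equiv.sum_comp w⁻¹]
  refine Finset.sum_congr rfl fun i _ => ?_
  rw [Equiv.Perm.inv_def, Equiv.apply_symm_apply, mul_comm]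

/-- The normalisation of the modular `S`-matrix. -/
def normS (N k : ℕ) : ℂ := Complex.exp (Complex.I * Real.pi * ((N + 1) * N) / 4) /
  (Real.sqrt (((N : ℝ) + 1) * ((k : ℝ) + (N + 1)) ^ N) : ℂ)

theorem normS_ne_zero (N k : ℕ) : normS N k ≠ 0 := by
  refine div_ne_zero (Complex.exp_ne_zero _) ?_
  rw [Complex.ofReal_ne_zero, Real.sqrt_ne_zero']
  positivity

/-- The Weyl sum is a Leibniz expansion. Replacing `λ + ρ` by the positions changes it by a constant
vector, which pairs to zero with `σ + ρ`. -/
theorem modularS_eq {N k : ℕ} (l s : Weight N k) :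
    modularS N k l s = normS N k * slater (rootY s)⁻¹ (pos l.1) := by
  rw [modularS, ← normS, slater, Matrix.det_apply']
  congr 1
  rw [← Equiv.sum_comp (Equiv.inv (Equiv.Perm (Fin (N + 1))))]
  refine Finset.sum_congr rfl fun w _ => ?_
  rw [Equiv.inv_apply, Equiv.Perm.sign_inv, inv_inv]
  congr 1
  have h1 : ∑ i, rhoShift s.1 i * rhoShift l.1 (w i) = ∑ i, pos l.1 (w i) * rhoShift s.1 i := by
    have : ∀ i, rhoShift s.1 i * rhoShift l.1 (w i) =
        pos l.1 (w i) * rhoShift s.1 i - rhoConst l.1 * rhoShift s.1 i := fun i => by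
      rw [rhoShift_eq l.1]; ring
    simp only [this]
    rw [Finset.sum_sub_distrib, ← Finset.mul_sum, sum_rhoShift]
    ring
  rw [h1, Complex.ofReal_sum, Finset.mul_sum, Complex.exp_sum]
  refine Finset.prod_congr rfl fun i _ => ?_
  rw [Matrix.of_apply, Pi.inv_apply, rootY, ← Complex.exp_neg, ← Complex.exp_int_mul]
  congr 1
  push_cast
  ring

/-! ## Bethe roots -/

theorem part_antitone {N : ℕ} (m : Fin (N + 1) → ℕ) : Antitone (part m) := by
  intro i j hij
  refine Finset.sum_le_sum_of_subset fun a => ?_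
  simp only [Finset.mem_filter, Finset.mem_univ, true_and]
  exact fun h => ⟨hij.trans h.1, h.2⟩

theorem lt_transp {N : ℕ} {m : Fin (N + 1) → ℕ} {i : Fin (N + 1)} {j : ℕ} (h : j ≤ part m i) :
    (i : ℕ) < transp m j := by
  have : Finset.Iic i ⊆ Finset.univ.filter fun i => j ≤ part m i := fun a ha => by
    rw [Finset.mem_Iic] at ha
    simpa using h.trans (part_antitone m ha)
  have := Finset.card_le_card this
  rw [Fin.card_Iic] at this
  exact this

theorem transp_le {N : ℕ} {m : Fin (N + 1) → ℕ} {i : Fin (N + 1)} {j : ℕ} (h : part m i < j) :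
    transp m j ≤ i := by
  have : (Finset.univ.filter fun i => j ≤ part m i) ⊆ Finset.Iio i := fun a ha => by
    simp only [Finset.mem_filter, Finset.mem_univ, true_and] at ha
    rw [Finset.mem_Iio]
    by_contra hc
    have := part_antitone m (not_lt.mp hc)
    omega
  have := Finset.card_le_card this
  rw [Fin.card_Iio] at this
  exact this

theorem transp_antitone {N : ℕ} (m : Fin (N + 1) → ℕ) : Antitone (transp m) := by
  intro i j hij
  refine Finset.card_le_card fun a => ?_
  simp only [Finset.mem_filter, Finset.mem_univ, true_and]
  exact fun h => hij.trans h

/-- Positions of the particles and of the holes. -/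
def allPos {N k : ℕ} (s : Weight N k) : Fin (N + 1) ⊕ Fin k → ℕ
  | .inl i => part s.1 i + (N - i)
  | .inr i => N + (k - i) - transp s.1 (k - i)

theorem allPos_lt {N k : ℕ} (s : Weight N k) (a : Fin (N + 1) ⊕ Fin k) :
    allPos s a < k + (N + 1) := by
  rcases a with i | i
  · have := part_le s i
    simp only [allPos]
    omega
  · simp only [allPos]
    omega

theorem transp_le_last {N k : ℕ} (s : Weight N k) (i : Fin k) : transp s.1 (k - i) ≤ N :=
  transp_le (i := Fin.last N) (by rw [part_last]; omega)

/-- Particle-hole duality for a partition in a box: the numbers attached to its rows and to its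
columns are disjoint. The case of a row against a column depends on whether the corresponding box
lies in the diagram. -/
theorem allPos_injective {N k : ℕ} (s : Weight N k) : Function.Injective (allPos s) := by
  have hcross : ∀ (i : Fin (N + 1)) (j : Fin k), allPos s (.inl i) ≠ allPos s (.inr j) := by
    intro i j h
    have h1 := transp_le_last s j
    have hi : (i : ℕ) ≤ N := Nat.lt_succ_iff.mp i.2
    simp only [allPos] at h
    by_cases hc : k - (j : ℕ) ≤ part s.1 i
    · have := lt_transp hc
      omega
    · have := transp_le (not_le.mp hc)
      omega
  rintro (i | i) (j | j) h
  · congr 1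
    have h1 : StrictAnti fun i : Fin (N + 1) => part s.1 i + (N - i) := fun a b hab => by
      have := part_antitone s.1 hab.le
      have h2 : (a : ℕ) < b := hab
      have := b.2
      simp only
      omega
    exact h1.injective h
  · exact absurd h (hcross i j)
  · exact absurd h.symm (hcross j i)
  · congr 1
    have h1 : StrictAnti fun i : Fin k => N + (k - i) - transp s.1 (k - i) := fun a b hab => by
      have h2 : (a : ℕ) < b := hab
      have h3 := transp_antitone s.1 (show k - (b : ℕ) ≤ k - a by omega)
      have h4 := transp_le_last s a
      have h5 := transp_le_last s b
      have := b.2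
      simp only
      omega
    exact h1.injective h

/-- The sign is `exp (iπ)`, half a turn of the circle of `k + n` sites; it turns the half-integral
shift in the Bethe root into the integral hole position times the common phase. -/
theorem neg_betheRoot_inv {N k : ℕ} (s : Weight N k) (i : Fin k) :
    -(betheRoot s i)⁻¹ = zetaRoot N k ^ allPos s (.inr i) * phase s := by
  have h1 := transp_le_last s i
  have hi : (i : ℕ) ≤ k := i.2.le
  rw [betheRoot, ← Complex.exp_neg, neg_eq_neg_one_mul, ← Complex.exp_pi_mul_I, ← Complex.exp_add,
    zetaRoot, phase, ← Complex.exp_nat_mul, ← Complex.exp_add]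
  congr 1
  have hK := level_ne_zero N k
  have hn : ((N : ℂ) + 1) ≠ 0 := by exact_mod_cast Nat.succ_ne_zero N
  simp only [allPos, rhoConst]
  rw [Nat.cast_sub (by omega), Nat.cast_add, Nat.cast_sub hi]
  push_cast
  field_simp
  ring

theorem prod_one_sub_allPos {N k : ℕ} (s : Weight N k) (g : ℂ) :
    ∏ a, (1 - zetaRoot N k ^ allPos s a * g) = 1 - g ^ (k + (N + 1)) := by
  have hz := isPrimitiveRoot_zetaRoot N k
  have hpos : 0 < k + (N + 1) := by omega
  have h1 := hz.pow_sub_pow_eq_prod_sub_mul 1 g hpos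
  rw [one_pow] at h1
  rw [h1]
  have hinj : Function.Injective fun a => zetaRoot N k ^ allPos s a := fun a b hab =>
    allPos_injective s (hz.pow_inj (allPos_lt s a) (allPos_lt s b) hab)
  have himg : Finset.univ.image (fun a => zetaRoot N k ^ allPos s a) =
      Polynomial.nthRootsFinset (k + (N + 1)) (1 : ℂ) := by
    refine Finset.eq_of_subset_of_card_le ?_ ?_
    · intro x hx
      rw [Finset.mem_image] at hx
      obtain ⟨a, -, rfl⟩ := hx
      rw [Polynomial.mem_nthRootsFinset hpos, ← pow_mul, mul_comm, pow_mul, hz.pow_eq_one, one_pow]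
    · rw [Finset.card_image_of_injective _ hinj, hz.card_nthRootsFinset]
      simp [add_comm]
  rw [← himg, Finset.prod_image fun a _ b _ h => hinj h]

/-- Particles and holes together exhaust the residues modulo `k + n`, so the product runs over all
`(k + n)`-th roots of unity, rotated by the phase. -/
theorem prod_bethe_mul_prod_rootY {N k : ℕ} (s : Weight N k) :
    (∏ i : Fin k, (1 + Polynomial.C (betheRoot s i)⁻¹ * Polynomial.X)) *
      ∏ j, (1 - Polynomial.C (rootY s j) * Polynomial.X) =
    1 - Polynomial.C (phase s ^ (k + (N + 1))) * Polynomial.X ^ (k + (N + 1)) := by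
  refine Polynomial.funext fun t => ?_
  have h1 := prod_one_sub_allPos s (phase s * t)
  rw [Fintype.prod_sum_type, mul_comm] at h1
  simp only [Polynomial.eval_mul, Polynomial.eval_prod, Polynomial.eval_add, Polynomial.eval_sub,
    Polynomial.eval_one, Polynomial.eval_C, Polynomial.eval_X, Polynomial.eval_pow]
  rw [← mul_pow, ← h1]
  congr 1
  · refine Finset.prod_congr rfl fun i _ => ?_
    rw [← mul_assoc, ← neg_betheRoot_inv]
    ring
  · refine Finset.prod_congr rfl fun i _ => ?_
    rw [← mul_assoc, rootY_eq]
    rfl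

/-- Below degree `k + n` the product formula says that the generating function of the elementary
functions of the inverse Bethe roots is inverse to `∏ (1 - y_j X)`. -/
theorem elem_betheRoot {N k : ℕ} (s : Weight N k) {d : ℤ} (hd : d < k + (N + 1)) :
    elem (List.ofFn fun i : Fin k => (betheRoot s i)⁻¹) d = complete (rootY s) d := by
  rw [elem, complete]
  split_ifs with h
  · rfl
  rw [List.map_ofFn, List.prod_ofFn]
  set P : Polynomial ℂ := ∏ i : Fin k, (1 + Polynomial.C (betheRoot s i)⁻¹ * Polynomial.X) with hP
  have h1 := congrArg (Polynomial.toPowerSeries) (prod_bethe_mul_prod_rootY s)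
  rw [Polynomial.coe_mul] at h1
  have h2 : ((∏ j, (1 - Polynomial.C (rootY s j) * Polynomial.X) : Polynomial ℂ) :
      PowerSeries ℂ) = ∏ j, (1 - PowerSeries.C (rootY s j) * PowerSeries.X) := by
    rw [← Polynomial.coeToPowerSeries.ringHom_apply, map_prod]
    simp
  have h3 : (P : PowerSeries ℂ) = hSeries (rootY s) * (1 -
      PowerSeries.C (phase s ^ (k + (N + 1))) * PowerSeries.X ^ (k + (N + 1))) := by
    have h4 := prod_one_sub_mul_hSeries (rootY s)
    rw [h2] at h1
    calc (P : PowerSeries ℂ) = P * ((∏ j, (1 - PowerSeries.C (rootY s j) * PowerSeries.X)) *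
          hSeries (rootY s)) := by rw [h4, mul_one]
      _ = hSeries (rootY s) * (P * (∏ j, (1 - PowerSeries.C (rootY s j) * PowerSeries.X))) := by
        ring
      _ = _ := by rw [h1]; simp
  change P.coeff d.toNat = _
  rw [← Polynomial.coeff_coe, h3, mul_sub, mul_one, map_sub, ← mul_assoc,
    PowerSeries.coeff_mul_X_pow', if_neg (by omega), sub_zero]

theorem betheVec_eq {N k : ℕ} (hN : 1 ≤ N) (s : Weight N k) :
    betheVec s = (slater (rootY s) fun i => N - i)⁻¹ • wave k (rootY s) := by
  have h0 := slater_delta_ne_zero (rootY_injective s)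
  ext m
  have h1 := opB_prod_apply hN (List.ofFn fun i : Fin k => (betheRoot s i)⁻¹) m
  rw [List.map_ofFn, List.length_ofFn] at h1
  rw [betheVec, Finsupp.smul_apply, wave_apply]
  refine h1.trans ?_
  split_ifs with hm
  swap
  · simp
  rw [← det_complete_mul_slater _ _ (pos_nonneg m), smul_eq_mul, mul_comm _ (slater _ _),
    inv_mul_cancel_left₀ h0]
  congr 1
  ext i j
  rw [Matrix.of_apply, Matrix.of_apply, elem_betheRoot]
  have := pos_le m i
  have := j.2
  omega

/-! ## Orthogonality of the plane waves -/

theorem dot_toState {N k : ℕ} (g : State N) (f : Weight N k → ℂ) :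
    dot g (toState f) = ∑ m : Weight N k, f m * g m.1 := by
  simp [toState, dot_ket]

theorem toState_val {N k : ℕ} (f : Weight N k → ℂ) (m : Weight N k) : toState f m.1 = f m := by
  rw [toState_apply, dif_pos m.2]

theorem inn_toState {N k : ℕ} (f g : Weight N k → ℂ) :
    inn (toState f) (toState g) = ∑ m, (starRingEnd ℂ) (f m) * g m := by
  rw [inn, Finsupp.sum_of_support_subset (s := Finset.univ.map
    (Function.Embedding.subtype fun m : Fin (N + 1) → ℕ => ∑ i, m i = k))]
  · rw [Finset.sum_map]
    refine Finset.sum_congr rfl fun m _ => ?_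
    rw [Function.Embedding.subtype_apply, toState_val, toState_val]
  · intro m hm
    rw [Finsupp.mem_support_iff, toState_apply] at hm
    split_ifs at hm with h
    · exact Finset.mem_map.mpr ⟨⟨m, h⟩, Finset.mem_univ _, rfl⟩
    · exact absurd rfl hm
  · simp

theorem conj_slater {N k : ℕ} (s : Weight N k) (l : Fin (N + 1) → ℤ) :
    (starRingEnd ℂ) (slater (rootY s) l) = slater (rootY s)⁻¹ l := by
  rw [slater, slater, RingHom.map_det]
  congr 1
  ext i j
  simp only [RingHom.mapMatrix_apply, Matrix.map_apply, Matrix.of_apply, map_zpow₀, Pi.inv_apply]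
  congr 1
  rw [rootY, ← Complex.exp_conj, ← Complex.exp_neg]
  congr 1
  have : (k : ℂ) + (N + 1) = ((k + (N + 1) : ℝ) : ℂ) := by push_cast; rfl
  rw [this]
  simp only [map_mul, map_div₀, Complex.conj_ofReal, Complex.conj_I, Complex.conj_ofNat]
  ring

theorem slater_vac {N k : ℕ} {y : Fin (N + 1) → ℂ} (hy : ∏ j, y j = 1) :
    slater y (pos (vac N k).1) = slater y fun i => N - i := by
  rw [← slater_add_const hy (fun i => (N : ℤ) - i) (k : ℤ)]
  congr 1
  funext i
  refine (pos_unique (l := fun i : Fin (N + 1) => (N : ℤ) - i + k) 0 ?_ ?_ i).trans (sub_zero _)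
  · simp [vac]
  · intro i
    have : i.castSucc ≠ Fin.last N := (Fin.castSucc_lt_last i).ne
    simp [vac, this]
    ring

/-- The squared norm of a plane wave. -/
def waveNorm {N k : ℕ} (s : Weight N k) : ℂ :=
  ∑ m : Weight N k, slater (rootY s) (pos m.1) * slater (rootY s)⁻¹ (pos m.1)

/-- The roots lie on the unit circle, so this is a sum of absolute squares; the term of the empty
partition is a Vandermonde determinant with distinct nodes. -/
theorem waveNorm_ne_zero {N k : ℕ} (s : Weight N k) : waveNorm s ≠ 0 := by
  have h1 : waveNorm s = ((∑ m : Weight N k, Complex.normSq (slater (rootY s) (pos m.1)) : ℝ) : ℂ) := by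
    rw [waveNorm, Complex.ofReal_sum]
    refine Finset.sum_congr rfl fun m _ => ?_
    rw [← conj_slater, Complex.mul_conj]
  rw [h1, Complex.ofReal_ne_zero]
  refine (Finset.sum_pos' (fun m _ => Complex.normSq_nonneg _)
    ⟨vac N k, Finset.mem_univ _, ?_⟩).ne'
  rw [Complex.normSq_pos, slater_vac (prod_rootY s)]
  exact slater_delta_ne_zero (rootY_injective s)

/-- If the pairing is nonzero, the eigenvalues of `T(u)` agree for all `u`, so the roots agree up to
order, and these determine the weight. -/
theorem sum_slater_mul_slater {N k : ℕ} (hN : 1 ≤ N) (s t : Weight N k) :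
    ∑ m : Weight N k, slater (rootY s) (pos m.1) * slater (rootY t)⁻¹ (pos m.1) =
      if s = t then waveNorm s else 0 := by
  split_ifs with h
  · subst h; rfl
  · by_contra hne
    refine h ?_
    have h1 : dot (wave k (rootY t)⁻¹) (wave k (rootY s)) ≠ 0 := by
      rw [wave, wave, dot_toState]
      simp only [toState_val]
      exact hne
    have h2 := prod_one_add_eq_of_dot_ne_zero hN (prod_rootY s) (rootY_pow s) (prod_rootY t)
      (rootY_pow t) h1
    obtain ⟨p, hp⟩ := exists_perm_of_prod_eq (fun j => inv_ne_zero (rootY_ne_zero s j))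
      (fun i j hij => rootY_injective s (inv_injective hij)) h2
    exact eq_of_rootY_perm p fun j => inv_injective (hp j)

/-! ## The Verlinde formula -/

/-- The eigenvalue of `s_λ(𝓐)` on the plane wave of `σ`. -/
def chi {N k : ℕ} (l s : Weight N k) : ℂ := schurVal (rootY s)⁻¹ l

theorem modularS_vac_ne_zero {N k : ℕ} (s : Weight N k) : modularS N k (vac N k) s ≠ 0 := by
  rw [modularS_eq, slater_vac (prod_rootY_inv s)]
  exact mul_ne_zero (normS_ne_zero N k)
    (slater_delta_ne_zero fun i j h => rootY_injective s (inv_injective h))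

theorem modularS_eq_chi {N k : ℕ} (l s : Weight N k) :
    modularS N k l s = chi l s * modularS N k (vac N k) s := by
  rw [modularS_eq, modularS_eq, slater_vac (prod_rootY_inv s), chi,
    ← schurVal_mul_slater (prod_rootY_inv s)]
  ring

theorem chi_vac {N k : ℕ} (s : Weight N k) : chi (vac N k) s = 1 := by
  have := modularS_eq_chi (vac N k) s
  exact mul_right_cancel₀ (modularS_vac_ne_zero s) (by rw [← this, one_mul])

theorem modularS_mul_wave {N k : ℕ} (hN : 1 ≤ N) :
    modularS N k * Matrix.of (fun m s : Weight N k => slater (rootY s) (pos m.1) *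
      (normS N k * waveNorm s)⁻¹) = 1 := by
  ext t s
  rw [Matrix.mul_apply, Matrix.one_apply]
  have : ∀ m : Weight N k, modularS N k t m * Matrix.of (fun m s : Weight N k =>
      slater (rootY s) (pos m.1) * (normS N k * waveNorm s)⁻¹) m s =
      (normS N k * (normS N k * waveNorm s)⁻¹) *
        (slater (rootY s) (pos m.1) * slater (rootY t)⁻¹ (pos m.1)) := fun m => by
    rw [modularS_symm, modularS_eq, Matrix.of_apply]
    ring
  simp only [this]
  rw [← Finset.mul_sum, sum_slater_mul_slater hN]
  have h1 := normS_ne_zero N k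
  have h2 := waveNorm_ne_zero s
  by_cases h : s = t
  · subst h
    simp
    field_simp
  · rw [if_neg h, if_neg (Ne.symm h), mul_zero]

theorem modularS_inv {N k : ℕ} (hN : 1 ≤ N) (v s : Weight N k) :
    (modularS N k)⁻¹ v s = slater (rootY s) (pos v.1) * (normS N k * waveNorm s)⁻¹ := by
  rw [Matrix.inv_eq_right_inv (modularS_mul_wave hN)]
  rfl

theorem modularS_mul_inv {N k : ℕ} (hN : 1 ≤ N) : modularS N k * (modularS N k)⁻¹ = 1 := by
  rw [Matrix.inv_eq_right_inv (modularS_mul_wave hN), modularS_mul_wave hN]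

theorem toState_eq_ket {N k : ℕ} (m : Weight N k) : toState (Pi.single m 1) = ket m.1 := by
  simp [toState, Pi.single_apply]

theorem toState_sum_smul {N k : ℕ} {ι : Type*} (S : Finset ι) (a : ι → ℂ)
    (f : ι → Weight N k → ℂ) : ∑ s ∈ S, a s • toState (f s) =
      toState fun m => ∑ s ∈ S, a s * f s m := by
  simp only [toState, Finset.smul_sum, Finset.sum_smul, smul_smul]
  exact Finset.sum_comm

theorem ket_eq_sum_wave {N k : ℕ} (hN : 1 ≤ N) (m : Weight N k) :
    ket m.1 = ∑ s : Weight N k,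
      (modularS N k s m * (normS N k * waveNorm s)⁻¹) • wave k (rootY s) := by
  simp only [wave]
  rw [toState_sum_smul, ← toState_eq_ket]
  congr 1
  funext v
  -- Orthogonality gave a right inverse; for a square matrix it is also a left inverse, and this is
  -- the completeness relation.
  have h1 : (modularS N k)⁻¹ * modularS N k = 1 := mul_eq_one_comm.mp (modularS_mul_inv hN)
  have h2 := congrFun (congrFun h1 v) m
  rw [Matrix.mul_apply, Matrix.one_apply] at h2
  rw [Pi.single_apply, ← h2]
  refine Finset.sum_congr rfl fun s _ => ?_
  rw [modularS_inv hN]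
  ring

theorem fusionCoeff_eq {N k : ℕ} (l m v : Weight N k) : fusionCoeff N k l m v =
    ∑ s, chi l s * modularS N k m s * (modularS N k)⁻¹ v s := by
  refine Finset.sum_congr rfl fun s _ => ?_
  rw [modularS_eq_chi l]
  have := modularS_vac_ne_zero s
  field_simp

theorem schurOp_ket {N k : ℕ} (hN : 1 ≤ N) (l m : Weight N k) :
    schurOp 1 l.toPart (ket m.1) = toState fun v => fusionCoeff N k l m v := by
  have h1 : ∀ s : Weight N k, schurOp 1 l.toPart
      ((modularS N k s m * (normS N k * waveNorm s)⁻¹) • wave k (rootY s)) =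
      (modularS N k s m * (normS N k * waveNorm s)⁻¹ * chi l s) •
        toState fun m : Weight N k => slater (rootY s) (pos m.1) := fun s => by
    rw [map_smul, schurOp_wave (prod_rootY s) (rootY_pow s), smul_smul, chi, wave]
  rw [ket_eq_sum_wave hN, map_sum, Finset.sum_congr rfl fun s _ => h1 s, toState_sum_smul]
  refine congrArg toState ?_
  funext v
  rw [fusionCoeff_eq]
  refine Finset.sum_congr rfl fun s _ => ?_
  rw [modularS_inv hN, modularS_symm s m]
  ring

theorem combConst_eq {N k : ℕ} (hN : 1 ≤ N) (l m v : Weight N k) :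
    combConst N k 1 l m v = fusionCoeff N k l m v := by
  rw [combConst, schurOp_ket hN, toState_val]

/-- For fixed `s` the map `l ↦ chi l s` is a character of the product: multiplied by the vacuum
entry of `S` this is the Verlinde formula, with `S⁻¹` cancelled by `S`. -/
theorem sum_combConst_mul_chi {N k : ℕ} (hN : 1 ≤ N) (l m s : Weight N k) :
    ∑ v, combConst N k 1 l m v * chi v s = chi l s * chi m s := by
  have h0 := modularS_vac_ne_zero s
  apply mul_right_cancel₀ h0
  rw [Finset.sum_mul]
  simp only [mul_assoc, ← modularS_eq_chi, combConst_eq hN, fusionCoeff_eq, Finset.sum_mul]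
  rw [Finset.sum_comm]
  have h1 : ∀ t : Weight N k, ∑ v, chi l t * (modularS N k m t * ((modularS N k)⁻¹ v t *
      modularS N k v s)) = chi l t * modularS N k m t * if s = t then 1 else 0 := by
    intro t
    have h2 := congrFun (congrFun (modularS_mul_inv (k := k) hN) s) t
    rw [Matrix.mul_apply, Matrix.one_apply] at h2
    rw [← h2, Finset.mul_sum]
    refine Finset.sum_congr rfl fun v _ => ?_
    rw [modularS_symm s v]
    ring
  simp only [h1, mul_ite, mul_one, mul_zero, Finset.sum_ite_eq, Finset.mem_univ, if_true]

/-- The values of the characters of the Verlinde algebra. -/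
def charMap (N k : ℕ) : (Weight N k → ℂ) →ₗ[ℂ] (Weight N k → ℂ) :=
  (Matrix.of fun l s : Weight N k => chi l s).vecMulLinear

theorem charMap_apply {N k : ℕ} (f : Weight N k → ℂ) (s : Weight N k) :
    charMap N k f s = ∑ l, f l * chi l s := rfl

theorem charMap_injective {N k : ℕ} (hN : 1 ≤ N) : Function.Injective (charMap N k) := by
  rw [← LinearMap.ker_eq_bot, LinearMap.ker_eq_bot']
  intro f hf
  have h1 : Matrix.vecMul f (modularS N k) = 0 := by
    funext s
    have h2 := congrFun hf s
    rw [charMap_apply] at h2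
    have h3 : Matrix.vecMul f (modularS N k) s =
        (∑ l, f l * chi l s) * modularS N k (vac N k) s := by
      rw [Finset.sum_mul]
      refine Finset.sum_congr rfl fun l _ => ?_
      rw [mul_assoc, ← modularS_eq_chi l]
    rw [h3, h2, Pi.zero_apply, zero_mul]
  rw [← Matrix.vecMul_one f, ← modularS_mul_inv hN, ← Matrix.vecMul_vecMul, h1,
    Matrix.zero_vecMul]

theorem charMap_bijective {N k : ℕ} (hN : 1 ≤ N) : Function.Bijective (charMap N k) :=
  ⟨charMap_injective hN, LinearMap.injective_iff_surjective.mp (charMap_injective hN)⟩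

theorem charMap_mul {N k : ℕ} (hN : 1 ≤ N) (f g : Weight N k → ℂ) :
    charMap N k (strMul (combConst N k 1) f g) = charMap N k f * charMap N k g := by
  funext s
  rw [Pi.mul_apply, charMap_apply, charMap_apply, charMap_apply, Finset.sum_mul_sum]
  simp only [strMul, Finset.sum_mul]
  rw [Finset.sum_comm]
  refine Finset.sum_congr rfl fun l _ => ?_
  rw [Finset.sum_comm]
  refine Finset.sum_congr rfl fun m _ => ?_
  simp only [mul_assoc]
  rw [← Finset.mul_sum, ← Finset.mul_sum, sum_combConst_mul_chi hN]
  ring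

theorem charMap_vac {N k : ℕ} : charMap N k (Pi.single (vac N k) 1) = 1 := by
  funext s
  rw [charMap_apply]
  simp [Pi.single_apply, chi_vac]

theorem isCommAlg_combConst {N k : ℕ} (hN : 1 ≤ N) :
    IsCommAlg (combConst N k 1) (Pi.single (vac N k) 1) where
  comm f g := charMap_injective hN (by rw [charMap_mul hN, charMap_mul hN, mul_comm])
  assoc f g h := charMap_injective hN (by
    rw [charMap_mul hN, charMap_mul hN, charMap_mul hN, charMap_mul hN, mul_assoc])
  unit f := charMap_injective hN (by rw [charMap_mul hN, charMap_vac, one_mul])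

/-! ## Integrality -/

/-- The operators that preserve the lattice of states with integral coordinates. -/
def integralOps (N : ℕ) : Subring (Module.End ℂ (State N)) where
  carrier := {X | ∀ f : State N, (∀ m, ∃ a : ℤ, f m = a) → ∀ m, ∃ a : ℤ, X f m = a}
  mul_mem' {X Y} hX hY f hf := hX _ (hY _ hf)
  one_mem' _ hf := hf
  add_mem' {X Y} hX hY f hf m := by
    obtain ⟨a, ha⟩ := hX f hf m
    obtain ⟨b, hb⟩ := hY f hf m
    exact ⟨a + b, by rw [LinearMap.add_apply, Finsupp.add_apply, ha, hb]; push_cast; rfl⟩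
  zero_mem' f _ m := ⟨0, by simp⟩
  neg_mem' {X} hX f hf m := by
    obtain ⟨a, ha⟩ := hX f hf m
    exact ⟨-a, by rw [LinearMap.neg_apply, Finsupp.neg_apply, ha]; push_cast; rfl⟩

theorem create_mem_integralOps {N : ℕ} (i : Fin (N + 1)) : create i ∈ integralOps N := by
  intro f hf m
  rw [create_apply]
  split_ifs
  · exact hf _
  · exact ⟨0, by simp⟩

theorem annih_mem_integralOps {N : ℕ} (i : Fin (N + 1)) : annih i ∈ integralOps N := by
  intro f hf m
  rw [annih_apply]
  exact hf _

theorem hOp_mem_integralOps {N : ℕ} (r : ℕ) : hOp 1 r ∈ integralOps N := by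
  refine Subring.sum_mem _ fun ε _ => ?_
  rw [one_pow, one_smul]
  refine Subring.mul_mem _ (Subring.mul_mem _ (Subring.pow_mem _ (create_mem_integralOps _) _)
    (Subring.list_prod_mem _ fun X hX => ?_)) (Subring.pow_mem _ (annih_mem_integralOps _) _)
  obtain ⟨j, rfl⟩ := (List.mem_ofFn' _ _).mp hX
  exact Subring.pow_mem _ (Subring.mul_mem _ (create_mem_integralOps _)
    (annih_mem_integralOps _)) _

theorem schurOp_mem_integralOps {N : ℕ} (l : Fin N → ℕ) : schurOp 1 l ∈ integralOps N := by
  refine Subring.sum_mem _ fun w _ => Subring.zsmul_mem _ (Subring.list_prod_mem _ fun X hX => ?_) _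
  obtain ⟨j, rfl⟩ := (List.mem_ofFn' _ _).mp hX
  simp only [hOpInt]
  split_ifs
  · exact hOp_mem_integralOps _
  · exact Subring.zero_mem _

theorem exists_int_combConst {N k : ℕ} (l m v : Weight N k) :
    ∃ a : ℤ, combConst N k 1 l m v = a := by
  refine schurOp_mem_integralOps _ (ket m.1) (fun m' => ?_) v.1
  rw [ket_apply]
  split_ifs
  · exact ⟨1, by simp⟩
  · exact ⟨0, by simp⟩

/-! ## Extension of scalars of an algebra given by structure constants -/

theorem strMul_intCast {ι : Type} [Fintype ι] {c : ι → ι → ι → ℤ} (f g : ι → ℤ) :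
    strMul (fun i j l => (c i j l : ℂ)) (fun i => (f i : ℂ)) (fun i => (g i : ℂ)) =
      fun l => ((strMul c f g l : ℤ) : ℂ) := by
  funext l
  simp [strMul]

theorem intCast_comp_injective {ι : Type} : Function.Injective fun (f : ι → ℤ) (i : ι) => (f i : ℂ) :=
  fun _ _ h => funext fun i => Int.cast_injective (congrFun h i)

/-- The axioms are identities between integers, so they may be checked after the injective cast to
`ℂ`. -/
theorem isCommAlg_of_intCast {ι : Type} [Fintype ι] {c : ι → ι → ι → ℤ} {e : ι → ℤ}
    (h : IsCommAlg (fun i j l => (c i j l : ℂ)) fun i => (e i : ℂ)) : IsCommAlg c e where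
  comm f g := intCast_comp_injective (by
    simp only [← strMul_intCast]; exact h.comm _ _)
  assoc f g k := intCast_comp_injective (by
    simp only [← strMul_intCast]
    exact h.assoc _ _ _)
  unit f := intCast_comp_injective (by
    simp only [← strMul_intCast]; exact h.unit _)

theorem strMul_single {R ι : Type} [CommRing R] [Fintype ι] [DecidableEq ι] (c : ι → ι → ι → R)
    (i j : ι) : strMul c (Pi.single i 1) (Pi.single j 1) = c i j := by
  funext l
  simp [strMul, Pi.single_apply]

/-- Coordinates of an algebra over `ℤ` given by structure constants. -/
def StrAlg.basisInt {ι : Type} [Fintype ι] [DecidableEq ι] {c : ι → ι → ι → ℤ} {e : ι → ℤ}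
    (h : IsCommAlg c e) : Module.Basis ι ℤ (StrAlg h) :=
  Module.Basis.ofEquivFun (AddEquiv.toIntLinearEquiv
    ({ (Equiv.refl (ι → ℤ)) with map_add' := fun _ _ => rfl } : StrAlg h ≃+ (ι → ℤ)))

theorem StrAlg.basisInt_apply {ι : Type} [Fintype ι] [DecidableEq ι] {c : ι → ι → ι → ℤ}
    {e : ι → ℤ} (h : IsCommAlg c e) (i : ι) :
    StrAlg.basisInt h i = StrAlg.of h (Pi.single i 1) := by
  rw [basisInt, Module.Basis.coe_ofEquivFun]
  rfl

/-- Coordinates of an algebra over `ℂ` given by structure constants. -/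
def StrAlg.basisComplex {ι : Type} [Fintype ι] [DecidableEq ι] {c : ι → ι → ι → ℂ} {e : ι → ℂ}
    (h : IsCommAlg c e) : Module.Basis ι ℂ (StrAlg h) :=
  Module.Basis.ofEquivFun
    ({ (Equiv.refl (ι → ℂ)) with
        map_add' := fun _ _ => rfl
        map_smul' := fun _ _ => rfl } : StrAlg h ≃ₗ[ℂ] (ι → ℂ))

theorem StrAlg.basisComplex_apply {ι : Type} [Fintype ι] [DecidableEq ι] {c : ι → ι → ι → ℂ}
    {e : ι → ℂ} (h : IsCommAlg c e) (i : ι) :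
    StrAlg.basisComplex h i = StrAlg.of h (Pi.single i 1) := by
  rw [basisComplex, Module.Basis.coe_ofEquivFun]
  rfl

theorem intCast_single {ι : Type} [DecidableEq ι] (i : ι) :
    (fun j => ((Pi.single i 1 : ι → ℤ) j : ℂ)) = Pi.single i 1 := by
  funext j
  by_cases h : j = i
  · subst h; simp
  · simp [h]

/-- The inclusion of the integral form. -/
def StrAlg.intCastHom {ι : Type} [Fintype ι] {c : ι → ι → ι → ℤ} {e : ι → ℤ}
    {C : ι → ι → ι → ℂ} {e' : ι → ℂ} (h : IsCommAlg c e) (h' : IsCommAlg C e')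
    (hc : ∀ i j l, C i j l = c i j l) (he : ∀ i, e' i = e i) : StrAlg h →+* StrAlg h' where
  toFun f := StrAlg.of h' fun i => ((f : ι → ℤ) i : ℂ)
  map_one' := funext fun i => (he i).symm
  map_mul' f g := by
    obtain rfl : C = fun i j l => (c i j l : ℂ) := funext fun i => funext fun j => funext (hc i j)
    exact (strMul_intCast (c := c) f g).symm
  map_zero' := funext fun _ => Int.cast_zero
  map_add' _ _ := funext fun _ => Int.cast_add _ _

/-- The map out of the tensor product is an algebra homomorphism by its universal property, and it
carries a basis to a basis. -/
theorem StrAlg.exists_algEquiv {ι : Type} [Fintype ι] [DecidableEq ι] {c : ι → ι → ι → ℤ}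
    {e : ι → ℤ} {C : ι → ι → ι → ℂ} {e' : ι → ℂ} (h : IsCommAlg c e) (h' : IsCommAlg C e')
    (hc : ∀ i j l, C i j l = c i j l) (he : ∀ i, e' i = e i) :
    ∃ Φ : StrAlg h' ≃ₐ[ℂ] ℂ ⊗[ℤ] StrAlg h,
      ∀ l, Φ (StrAlg.of h' (Pi.single l 1)) = 1 ⊗ₜ[ℤ] StrAlg.of h (Pi.single l 1) := by
  set F : ℂ ⊗[ℤ] StrAlg h →ₐ[ℂ] StrAlg h' := Algebra.TensorProduct.lift
    (Algebra.ofId ℂ (StrAlg h')) (StrAlg.intCastHom h h' hc he).toIntAlgHom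
    (fun _ _ => Commute.all _ _) with hF
  have hF1 : ∀ l, F (1 ⊗ₜ[ℤ] StrAlg.of h (Pi.single l 1)) = StrAlg.of h' (Pi.single l 1) := by
    intro l
    rw [hF, Algebra.TensorProduct.lift_tmul, map_one, one_mul]
    exact intCast_single l
  set E := (Algebra.TensorProduct.basis ℂ (StrAlg.basisInt h)).equiv (StrAlg.basisComplex h')
    (Equiv.refl ι) with hE
  have hFE : F.toLinearMap = E.toLinearMap := by
    refine (Algebra.TensorProduct.basis ℂ (StrAlg.basisInt h)).ext fun l => ?_
    rw [LinearEquiv.coe_coe, hE, Module.Basis.equiv_apply, Algebra.TensorProduct.basis_apply,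
      StrAlg.basisInt_apply, StrAlg.basisComplex_apply]
    exact hF1 l
  have hbij : Function.Bijective F := by
    have : (F : ℂ ⊗[ℤ] StrAlg h → StrAlg h') = E := funext fun x => LinearMap.congr_fun hFE x
    rw [this]
    exact E.bijective
  refine ⟨(AlgEquiv.ofBijective F hbij).symm, fun l => ?_⟩
  rw [AlgEquiv.symm_apply_eq]
  exact (hF1 l).symm

/-- The Verlinde algebra is a product of copies of `ℂ`. -/
def charEquiv {N k : ℕ} (hN : 1 ≤ N)
    (h : IsCommAlg (combConst N k 1) (Pi.single (vac N k) 1)) :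
    StrAlg h ≃+* (Weight N k → ℂ) :=
  RingEquiv.ofBijective
    ({ toFun := charMap N k
       map_one' := charMap_vac
       map_mul' := charMap_mul hN
       map_zero' := map_zero _
       map_add' := map_add _ } : StrAlg h →+* (Weight N k → ℂ)) (charMap_bijective hN)

/-! ## Bethe vectors -/

theorem betheVec_eq_toState {N k : ℕ} (hN : 1 ≤ N) (s : Weight N k) :
    betheVec s = toState fun m : Weight N k =>
      (slater (rootY s) fun i => N - i)⁻¹ * slater (rootY s) (pos m.1) := by
  rw [betheVec_eq hN]
  simp [wave, toState, Finset.smul_sum, smul_smul]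

theorem inn_betheVec {N k : ℕ} (hN : 1 ≤ N) (s : Weight N k) :
    inn (betheVec s) (betheVec s) = ((slater (rootY s)⁻¹ fun i => N - i)⁻¹ *
      (slater (rootY s) fun i => N - i)⁻¹) * waveNorm s := by
  rw [betheVec_eq_toState hN, inn_toState, waveNorm, Finset.mul_sum]
  refine Finset.sum_congr rfl fun m _ => ?_
  rw [map_mul, map_inv₀, conj_slater, conj_slater]
  ring

theorem slater_inv_delta_ne_zero {N k : ℕ} (s : Weight N k) :
    slater (rootY s)⁻¹ (fun i => N - i) ≠ 0 :=
  slater_delta_ne_zero fun _ _ h => rootY_injective s (inv_injective h)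

/-- The coordinates of `b_σ` are proportional to the wave of `σ` and the character of `τ` to the
conjugate wave of `τ`, so orthogonality applies; the normalisation by the norm makes the diagonal
value one. Thus normalised Bethe vectors become indicator functions. -/
theorem charMap_betheHat {N k : ℕ} (hN : 1 ≤ N) (s : Weight N k) :
    charMap N k (betheHat s) = Pi.single s 1 := by
  funext t
  have h1 := slater_delta_ne_zero (rootY_injective s)
  have h2 := slater_inv_delta_ne_zero t
  have h3 := waveNorm_ne_zero s
  have hchi : ∀ m : Weight N k, chi m t =
      slater (rootY t)⁻¹ (pos m.1) * (slater (rootY t)⁻¹ fun i => N - i)⁻¹ := fun m => by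
    rw [chi, ← schurVal_mul_slater (prod_rootY_inv t), mul_assoc, mul_inv_cancel₀ h2, mul_one]
  rw [charMap_apply]
  have : ∀ m : Weight N k, betheHat s m * chi m t =
      ((slater (rootY s) fun i => N - i)⁻¹ / inn (betheVec s) (betheVec s) *
        (slater (rootY t)⁻¹ fun i => N - i)⁻¹) *
      (slater (rootY s) (pos m.1) * slater (rootY t)⁻¹ (pos m.1)) := fun m => by
    have hb : betheVec s m.1 = _ := (congrArg (fun f : State N => f m.1)
      (betheVec_eq_toState hN s)).trans (toState_val _ m)
    rw [betheHat, hchi, hb]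
    ring
  simp only [this]
  rw [← Finset.mul_sum, sum_slater_mul_slater hN, Pi.single_apply]
  by_cases h : s = t
  · subst h
    rw [if_pos rfl, if_pos rfl, inn_betheVec hN]
    field_simp
  · rw [if_neg h, if_neg (Ne.symm h), mul_zero]

theorem linearIndependent_betheVec {N k : ℕ} (hN : 1 ≤ N) :
    LinearIndependent ℂ (fun s : Weight N k => betheVec s) := by
  rw [Fintype.linearIndependent_iff]
  intro g hg t
  have h1 := congrArg (dot (wave k (rootY t)⁻¹)) hg
  rw [map_sum, map_zero, Finset.sum_eq_single t] at h1
  · rw [map_smul, betheVec_eq hN, map_smul, smul_smul, smul_eq_mul, wave, wave, dot_toState] at h1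
    simp only [toState_val] at h1
    rw [sum_slater_mul_slater hN, if_pos rfl] at h1
    have h2 := (mul_eq_zero.mp h1).resolve_right (waveNorm_ne_zero t)
    exact (mul_eq_zero.mp h2).resolve_right
      (inv_ne_zero (slater_delta_ne_zero (rootY_injective t)))
  · intro s _ hs
    rw [map_smul, betheVec_eq hN, map_smul, wave, wave, dot_toState]
    simp only [toState_val]
    rw [sum_slater_mul_slater hN, if_neg hs, smul_zero, smul_zero]
  · simp

theorem toState_mem {N k : ℕ} (f : Weight N k → ℂ) : toState f ∈ levelSpace N k := by
  rw [levelSpace, Finsupp.mem_supported]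
  intro m hm
  rw [Finset.mem_coe, Finsupp.mem_support_iff, toState_apply] at hm
  by_contra h
  exact hm (dif_neg h)

theorem span_betheVec {N k : ℕ} (hN : 1 ≤ N) :
    Submodule.span ℂ (Set.range fun s : Weight N k => betheVec s) = levelSpace N k := by
  apply le_antisymm
  · rw [Submodule.span_le]
    rintro _ ⟨s, rfl⟩
    simp only [betheVec_eq_toState hN]
    exact toState_mem _
  · rw [levelSpace, Finsupp.supported_eq_span_single, Submodule.span_le]
    rintro _ ⟨m, hm, rfl⟩
    have h1 := ket_eq_sum_wave hN ⟨m, hm⟩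
    change ket m ∈ _
    rw [h1]
    refine Submodule.sum_mem _ fun s _ => Submodule.smul_mem _ _ ?_
    have h2 : wave k (rootY s) = (slater (rootY s) fun i => N - i) • betheVec s := by
      rw [betheVec_eq hN, smul_smul,
        mul_inv_cancel₀ (slater_delta_ne_zero (rootY_injective s)), one_smul]
    rw [h2]
    exact Submodule.smul_mem _ _ (Submodule.subset_span ⟨s, rfl⟩)

theorem exists_hOp_betheVec {N k : ℕ} (hN : 1 ≤ N) (s : Weight N k) (r : ℕ) :
    ∃ a : ℂ, hOp 1 r (betheVec s) = a • betheVec s := by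
  obtain ⟨a, ha⟩ := exists_hOp_wave (prod_rootY s) (rootY_pow s) r
  exact ⟨a, by rw [betheVec_eq hN, map_smul, ha, smul_comm]⟩

theorem betheComplete {N k : ℕ} (hN : 1 ≤ N) : BetheComplete N k := by
  refine ⟨linearIndependent_betheVec hN, span_betheVec hN, fun s =>
    ⟨exists_hOp_betheVec hN s, fun u => ⟨∏ j, (1 + u * (rootY s j)⁻¹), ?_⟩⟩⟩
  rw [betheVec_eq hN, map_smul, opT_wave hN (prod_rootY s) (rootY_pow s), smul_comm]

/-- The operators are simultaneously diagonal on the Bethe vectors, which span the space of level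
`k`. -/
theorem hOp_comm {N k : ℕ} (hN : 1 ≤ N) (r s : ℕ) (f : State N) (hf : f ∈ levelSpace N k) :
    hOp 1 r (hOp 1 s f) = hOp 1 s (hOp 1 r f) := by
  have h : Set.EqOn (hOp 1 r * hOp 1 s : Module.End ℂ (State N))
      (hOp 1 s * hOp 1 r : Module.End ℂ (State N))
      (Submodule.span ℂ (Set.range fun t : Weight N k => betheVec t)) := by
    refine LinearMap.eqOn_span' ?_
    rintro _ ⟨t, rfl⟩
    obtain ⟨a, ha⟩ := exists_hOp_betheVec hN t r
    obtain ⟨b, hb⟩ := exists_hOp_betheVec hN t s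
    simp only [Module.End.mul_apply, ha, hb, map_smul, smul_smul, mul_comm]
  rw [span_betheVec hN] at h
  exact h hf

end

end PhaseModel

/-! ### The theorem on the fusion ring and the Bethe vectors -/

theorem mainTheorem6 (N k : ℕ) (hN : 1 ≤ N) :
    -- the entries of the determinants `s_λ(𝓐)` commute on `ℂP_k⁺`
    (∀ (r s : ℕ), ∀ f ∈ PhaseModel.levelSpace N k,
      PhaseModel.hOp 1 r (PhaseModel.hOp 1 s f) = PhaseModel.hOp 1 s (PhaseModel.hOp 1 r f)) ∧
    -- `λ̂ * μ̂ = s_λ(𝓐) μ̂` is a product on `ℂP_k⁺`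
    (∀ l m : PhaseModel.Weight N k,
      PhaseModel.toState (PhaseModel.strMul (PhaseModel.combConst N k 1)
        (Pi.single l 1) (Pi.single m 1)) =
      PhaseModel.schurOp 1 l.toPart (PhaseModel.ket m.1)) ∧
    -- it is associative and commutative with unit `∅̂`
    ∃ hc : PhaseModel.IsCommAlg (PhaseModel.combConst N k 1) (Pi.single (PhaseModel.vac N k) 1),
    -- the fusion ring over `ℤ`, with the structure constants of the Verlinde formula
    ∃ c : PhaseModel.Weight N k → PhaseModel.Weight N k → PhaseModel.Weight N k → ℤ,
    (∀ l m v, (c l m v : ℂ) = PhaseModel.fusionCoeff N k l m v) ∧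
    ∃ hv : PhaseModel.IsCommAlg c (Pi.single (PhaseModel.vac N k) 1),
    -- isomorphism with the Verlinde algebra
    (∃ Φ : PhaseModel.StrAlg hc ≃ₐ[ℂ] ℂ ⊗[ℤ] PhaseModel.StrAlg hv,
      ∀ l, Φ (PhaseModel.StrAlg.of hc (Pi.single l 1)) =
        1 ⊗ₜ[ℤ] PhaseModel.StrAlg.of hv (Pi.single l 1)) ∧
    -- the normalised Bethe vectors are orthogonal idempotents
    (∀ s t : PhaseModel.Weight N k,
      PhaseModel.strMul (PhaseModel.combConst N k 1)
        (PhaseModel.betheHat s) (PhaseModel.betheHat t) =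
      if s = t then PhaseModel.betheHat s else 0) ∧
    -- completeness of the Bethe ansatz and semisimplicity are equivalent, and both hold
    (PhaseModel.BetheComplete N k ↔ IsSemisimpleRing (ℂ ⊗[ℤ] PhaseModel.StrAlg hv)) ∧
    PhaseModel.BetheComplete N k := by
  open PhaseModel in
  have hc := isCommAlg_combConst (k := k) hN
  choose c hcC using fun l m v : Weight N k => exists_int_combConst l m v
  have hv : IsCommAlg c (Pi.single (vac N k) 1) := by
    apply isCommAlg_of_intCast
    rw [intCast_single]
    simpa only [← hcC] using hc
  obtain ⟨Φ, hΦ⟩ := StrAlg.exists_algEquiv hv hc hcC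
    (fun i => (congrFun (intCast_single (vac N k)) i).symm)
  -- The equivalence of completeness and semisimplicity is obtained by proving both sides.
  refine ⟨fun r s f hf => hOp_comm hN r s f hf, fun l m => ?_, hc, c, fun l m v => ?_, hv,
    ⟨Φ, hΦ⟩, fun s t => ?_, iff_of_true (betheComplete hN) ?_, betheComplete hN⟩
  · rw [strMul_single, schurOp_ket hN]
    exact congrArg toState (funext fun v => combConst_eq hN l m v)
  · rw [← hcC, combConst_eq hN]
  -- Under the characters the claim becomes the pointwise product of two indicator functions.
  · apply charMap_injective hN
    rw [charMap_mul hN, charMap_betheHat hN, charMap_betheHat hN]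
    split_ifs with h
    · subst h
      rw [charMap_betheHat hN, ← Pi.single_mul, one_mul]
    · rw [map_zero]
      funext u
      by_cases hu : u = s
      · subst hu; simp [h]
      · simp [hu]
  -- The characters identify the algebra with a finite product of copies of `ℂ`, which is
  -- semisimple, and `Φ` transports this to the Verlinde algebra.
  · have : IsSemisimpleRing (StrAlg hc) := (charEquiv hN hc).symm.isSemisimpleRing
    exact Φ.toRingEquiv.isSemisimpleRing
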